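/- Let $p>1$ and $0<q<\min\{p-1,m\}$ ($p,q,m$ real, dimension $d=1$). Put $$\theta=\frac{p(m-q)}{(m+1)[p+(p-1)(q+1)]},\quad \ell=\frac{m-q}{(m+1)[(p-1)(q+1)+p]},\quad \eta_1=(p-1)(m+1)+p,\quad \eta_2=(p-1)(q+1)+p,$$ let $\mathcal B(a,b)$ be the Beta function and let $B^{-1}(\cdot;a,b)$ be the inverse of the incomplete Beta function $x\mapsto B(x;a,b)=\int_0^x t^{a-1}(1-t)^{b-1}\,dt$ on $[0,1]$. (1) There is exactly one function $u_{c,m}:\mathbb R\to[0,\infty)$ that is even, non-increasing on $[0,\infty)$, lies in $L^{q+1}(\mathbb R)$ with weak derivative in $L^p(\mathbb R)$, and for which there is $R\in(0,\infty)$ such that $u=u_{c,m}$ satisfies $u>0$ on $[0,R)$, $u=0$ on $[R,\infty)$ and solves the free boundary problem $$(|u'|^{p-2}u')'+u^m=u^q\ \text{ for } 0<r<R,\qquad u'(0)=0,\quad u(R)=u'(R)=0 .$$ (2) This solution is given by $$u_{c,m}(r)=\left(\frac{m+1}{q+1}\,B^{-1}\!\left(\bar C(R-r);\frac{p-1-q}{p(m-q)},1-\frac1p\right)\right)^{\frac1{m-q}},\qquad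 0\le r\le R,$$ where $$R=\left(\frac{p-1}{p}\right)^{\frac1p}\frac{(m+1)^{\frac{p-q-1}{p(m-q)}}(q+1)^{\frac1p-\frac{p-q-1}{p(m-q)}}}{m-q}\,\mathcal B\!\left(1-\frac1p,\frac{p-(q+1)}{p(m-q)}\right),$$ $$\bar C=\left(\frac p{p-1}\right)^{\frac1p}(m-q)(m+1)^{\frac{1+q-p}{p(m-q)}}(q+1)^{\frac{p-m-1}{p(m-q)}},$$ and $u_{c,m}(0)=\left(\frac{m+1}{q+1}\right)^{\frac1{m-q}}$. (3) The smallest constant $C_{q,m,p}\ge 0$ such that every $u\in L^{q+1}(\mathbb R)$ with weak derivative $u'\in L^p(\mathbb R)$ lies in $L^{m+1}(\mathbb R)$ and satisfies $\|u\|_{L^{m+1}}\le C_{q,m,p}\|u\|_{L^{q+1}}^{1-\theta}\|u'\|_{L^p}^{\theta}$ exists and equals $$C_{q,m,p}=\theta^{-\frac\theta p}(1-\theta)^{\frac\theta p-\frac1{m+1}}\left(\int_{\mathbb R}u_{c,m}^{q+1}\,dx\right)^{-\theta}=\left(\frac{2^p(p-1)^{1-p}\eta_1^{\frac{\eta_1}{m-q}}}{(m-q)^{2p-1}\eta_2^{\frac{\eta_2}{m-q}}}\,\mathcal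 B\!\left(\frac{\eta_2}{p(m-q)},\frac{2p-1}{p}\right)^p\right)^{-\ell}.$$ -/

import Mathlib

open MeasureTheory Set
open scoped ContDiff ENNReal

noncomputable section

namespace NagyGN

/-- `g` is the weak (distributional) derivative of `u` on the real line. -/
def HasWeakDeriv (u g : ℝ → ℝ) : Prop :=
  LocallyIntegrable u volume ∧ LocallyIntegrable g volume ∧
    ∀ φ : ℝ → ℝ, ContDiff ℝ ∞ φ → HasCompactSupport φ →
      ∫ x, u x * deriv φ x = -∫ x, g x * φ x

/-- `u ∈ L^{q+1}(ℝ)` with weak derivative `g ∈ L^p(ℝ)`. -/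
def MemX (p q : ℝ) (u g : ℝ → ℝ) : Prop :=
  MemLp u (ENNReal.ofReal (q + 1)) volume ∧ HasWeakDeriv u g ∧
    MemLp g (ENNReal.ofReal p) volume

/-- The non-negative, radially symmetric, radially non-increasing elements of
`{u ∈ L^{q+1}(ℝ) : u' ∈ L^p(ℝ)}`. -/
def MemXRad (p q : ℝ) (u : ℝ → ℝ) : Prop :=
  (∀ x, 0 ≤ u x) ∧ (∀ x, u x = u |x|) ∧ AntitoneOn u (Ici 0) ∧ ∃ g, MemX p q u g

/-- `u` is a radially non-increasing solution of the one-dimensional free boundary problem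
`(|u'|^{p-2} u')' + u^m = u^q` on `0 < r < R`, `u'(0) = 0`, `u(R) = u'(R) = 0`,
`u = 0` for `r ≥ R`; here `R ∈ (0, ∞)` is the first zero of `u`. -/
structure IsFreeBoundarySolution (p q m : ℝ) (u : ℝ → ℝ) (R : ℝ) : Prop where
  radius_pos : 0 < R
  mem : MemXRad p q u
  pos : ∀ r ∈ Ico 0 R, 0 < u r
  zero : ∀ r, R ≤ r → u r = 0
  differentiable : ∀ r ∈ Ioo 0 R, DifferentiableAt ℝ u r
  equation : ∀ r ∈ Ioo 0 R,
    DifferentiableAt ℝ (fun s => |deriv u s| ^ (p - 2) * deriv u s) r ∧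
      deriv (fun s => |deriv u s| ^ (p - 2) * deriv u s) r + u r ^ m = u r ^ q
  deriv_origin : HasDerivAt u 0 0
  deriv_radius : HasDerivAt u 0 R

/-- The incomplete Beta function `B(x; a, b)`. -/
def incBeta (x a b : ℝ) : ℝ := ∫ t in (0 : ℝ)..x, t ^ (a - 1) * (1 - t) ^ (b - 1)

/-- The inverse `B⁻¹(y; a, b)` of `x ↦ B(x; a, b)` on `[0, 1]`. -/
def incBetaInv (y a b : ℝ) : ℝ := Function.invFunOn (fun x => incBeta x a b) (Icc 0 1) y

/-- The interpolation exponent `θ` in dimension one. -/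
def theta (p q m : ℝ) : ℝ := p * (m - q) / ((m + 1) * (p + (p - 1) * (q + 1)))

/-- The constants `C` for which `‖u‖_{m+1} ≤ C ‖u‖_{q+1}^{1-θ} ‖u'‖_p^θ` holds for all real
`u ∈ L^{q+1}(ℝ)` with `u' ∈ L^p(ℝ)`. The right-hand side being finite, this includes
`u ∈ L^{m+1}(ℝ)`. -/
def gnConstants (p q m : ℝ) : Set ℝ :=
  {C | 0 ≤ C ∧ ∀ u g : ℝ → ℝ, MemX p q u g →
    eLpNorm u (ENNReal.ofReal (m + 1)) volume ≤
      ENNReal.ofReal C * eLpNorm u (ENNReal.ofReal (q + 1)) volume ^ (1 - theta p q m) *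
        eLpNorm g (ENNReal.ofReal p) volume ^ theta p q m}

/-- The support radius `R`. -/
def radius (p q m : ℝ) : ℝ :=
  ((p - 1) / p) ^ (1 / p) *
    ((m + 1) ^ ((p - q - 1) / (p * (m - q))) *
      (q + 1) ^ (1 / p - (p - q - 1) / (p * (m - q))) / (m - q)) *
    ProbabilityTheory.beta (1 - 1 / p) ((p - (q + 1)) / (p * (m - q)))

/-- The constant `C̄`. -/
def cBar (p q m : ℝ) : ℝ :=
  (p / (p - 1)) ^ (1 / p) * (m - q) * (m + 1) ^ ((1 + q - p) / (p * (m - q))) *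
    (q + 1) ^ ((p - m - 1) / (p * (m - q)))

def eta1 (p m : ℝ) : ℝ := (p - 1) * (m + 1) + p

def eta2 (p q : ℝ) : ℝ := (p - 1) * (q + 1) + p

def ell (p q m : ℝ) : ℝ := (m - q) / ((m + 1) * ((p - 1) * (q + 1) + p))

/-- The explicit value of the best constant. -/
def nagyConstant (p q m : ℝ) : ℝ :=
  (2 ^ p * (p - 1) ^ (1 - p) * eta1 p m ^ (eta1 p m / (m - q)) /
      ((m - q) ^ (2 * p - 1) * eta2 p q ^ (eta2 p q / (m - q))) *
    ProbabilityTheory.beta (eta2 p q / (p * (m - q))) ((2 * p - 1) / p) ^ p) ^ (-ell p q m)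

end NagyGN

end

namespace NagyGN

open Filter Topology

/-! The inequality is proved by calibration, without rearrangement or compactness. Write p' =
p/(p-1), W = `pot`, M = `peak` for the positive zero of W, and Φ = (p'W)^{1/p'} for the `momentum`.
An admissible v is a.e. a primitive of its weak derivative, takes arbitrarily small values on both
sides of every point, and is bounded. If sup|v| = M, then v climbs from 0 to height M and comes
back, so A = 2∫₀^M Φ ≤ ∫|v'|Φ(v) (`two_mul_primitive_abs_le_integral`). Hölder bounds the right side
by ‖v'‖_p (∫p'W(v))^{1/p'}, and ∫W(v) is a combination of the two norms of v (`action_le`). Weighted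
AM-GM, applied to the splitting of ∫|v|^{q+1}/(q+1) into ∫|v|^{m+1}/(m+1) and ∫W(v), gives the
multiplicative inequality (`rpow_le_of_action_le`). Both sides are homogeneous of degree one, so
sup|v| = M costs nothing.

Equality in Hölder asks for |u'|^p = p'W(u), which is the zero-energy level of the free boundary
problem. A solution conserves ((p-1)/p)|u'|^p - W(u); the conditions at R make this constant zero,
and then u'(0) = 0 forces u(0) = M (`IsFreeBoundarySolution.isProfile`). In the variable s =
(u/M)^{m-q} the first-order equation says that the incomplete Beta function of s is affine in r with
slope -`cBar` (`IsProfile.incBeta_eq`). This yields the formula, the radius and uniqueness;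
inverting it yields existence (`exists_isProfile`).

For the profile, the change of variable t = u(x) and testing the equation with u give two linear
relations among its integrals (`IsProfile.integrals_eq`). They express every norm through A and show
equality in the inequality (`IsProfile.extremal`). The substitution s = (t/M)^{m-q} turns A itself
into a Beta value, hence the closed form of the constant. -/

/-! ### Weak derivatives and primitives on the line -/

lemma intervalIntegrable_of_locallyIntegrable {g : ℝ → ℝ} (hg : LocallyIntegrable g volume)
    (a b : ℝ) : IntervalIntegrable g volume a b :=
  intervalIntegrable_iff.2
    ((hg.integrableOn_isCompact isCompact_uIcc).mono_set uIoc_subset_uIcc)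

/-- A compactly supported function on the line is supported in a symmetric bounded interval. -/
lemma exists_tsupport_subset_Ioo {φ : ℝ → ℝ} (hφ : HasCompactSupport φ) :
    ∃ K : ℝ, 0 < K ∧ tsupport φ ⊆ Ioo (-K) K := by
  obtain ⟨K, hK⟩ := hφ.isCompact.isBounded.subset_ball_lt 0 0
  refine ⟨K, hK.1, fun x hx => ?_⟩
  have := hK.2 hx
  simpa [Real.ball_eq_Ioo] using this

/-- Smooth primitives of test functions with vanishing integral are test functions. -/
lemma exists_test_primitive {χ : ℝ → ℝ} (hχ : ContDiff ℝ ∞ χ) (hc : HasCompactSupport χ)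
    (h0 : ∫ x, χ x = 0) :
    ∃ φ : ℝ → ℝ, ContDiff ℝ ∞ φ ∧ HasCompactSupport φ ∧ deriv φ = χ := by
  obtain ⟨K, hK, hsub⟩ := exists_tsupport_subset_Ioo hc
  have hcont : Continuous χ := hχ.continuous
  have hd : ∀ x, HasDerivAt (fun x => ∫ t in (-K)..x, χ t) (χ x) x := fun x =>
    intervalIntegral.integral_hasDerivAt_right (hcont.intervalIntegrable _ _)
      (hcont.stronglyMeasurableAtFilter _ _) hcont.continuousAt
  have hder : deriv (fun x => ∫ t in (-K)..x, χ t) = χ := funext fun x => (hd x).deriv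
  have hzero : ∀ x, x ∉ Ioo (-K) K → χ x = 0 := fun x hx =>
    image_eq_zero_of_notMem_tsupport fun h => hx (hsub h)
  refine ⟨_, ?_, ?_, hder⟩
  · rw [contDiff_infty_iff_deriv]
    exact ⟨fun x => (hd x).differentiableAt, by rw [hder]; exact hχ⟩
  · refine HasCompactSupport.intro (isCompact_Icc (a := -K) (b := K)) fun x hx => ?_
    rcases lt_or_ge x (-K) with h | h
    · rw [intervalIntegral.integral_symm]
      rw [intervalIntegral.integral_congr (g := fun _ => (0 : ℝ))]
      · simp
      · intro t ht
        rw [uIcc_of_le h.le] at ht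
        exact hzero t fun h' => absurd h'.1 (not_lt.2 ht.2)
    · have hx' : K < x := by
        by_contra h'
        exact hx ⟨h, not_lt.1 h'⟩
      rw [← h0]
      apply intervalIntegral.integral_eq_integral_of_support_subset
      intro t ht
      have : t ∈ Ioo (-K) K := by
        by_contra h'
        exact ht (hzero t h')
      exact ⟨this.1, (this.2.trans hx').le⟩

/-- The lemma of du Bois-Reymond on the real line. -/
lemma ae_eq_const_of_integral_mul_deriv_eq_zero {f : ℝ → ℝ} (hf : LocallyIntegrable f volume)
    (h : ∀ φ : ℝ → ℝ, ContDiff ℝ ∞ φ → HasCompactSupport φ → ∫ x, f x * deriv φ x = 0) :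
    ∃ c : ℝ, ∀ᵐ x, f x = c := by
  -- The bump has unit mass once normed. Subtracting (∫ψ) times it from a test function ψ leaves
  -- zero integral, that is, the derivative of a test function; the constant sought is the mean of f
  -- against the bump.
  let b : ContDiffBump (0 : ℝ) := ⟨1, 2, by norm_num, by norm_num⟩
  have hb : ContDiff ℝ ∞ (b.normed volume) := b.contDiff_normed
  have hbc : HasCompactSupport (b.normed volume) := b.hasCompactSupport_normed
  have hint : ∀ ψ : ℝ → ℝ, ContDiff ℝ ∞ ψ → HasCompactSupport ψ →
      Integrable (fun x => f x * ψ x) := fun ψ hψ hc => by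
    have := hf.integrable_smul_left_of_hasCompactSupport hψ.continuous hc
    simpa [smul_eq_mul, mul_comm] using this
  refine ⟨∫ x, f x * b.normed volume x, ?_⟩
  set c := ∫ x, f x * b.normed volume x with hc
  refine ae_eq_of_integral_contDiff_smul_eq hf (locallyIntegrable_const c) fun ψ hψ hψc => ?_
  have hχ : ContDiff ℝ ∞ (fun x => ψ x - (∫ y, ψ y) * b.normed volume x) :=
    hψ.sub (contDiff_const.mul hb)
  have hχc : HasCompactSupport (fun x => ψ x - (∫ y, ψ y) * b.normed volume x) := by
    have := hψc.sub (hbc.mul_left (f := fun _ => ∫ y, ψ y))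
    exact this
  have hψi : Integrable ψ := hψ.continuous.integrable_of_hasCompactSupport hψc
  have hbi : Integrable (b.normed volume) := hb.continuous.integrable_of_hasCompactSupport hbc
  have h0 : ∫ x, (ψ x - (∫ y, ψ y) * b.normed volume x) = 0 := by
    rw [integral_sub hψi (hbi.const_mul _), integral_const_mul, b.integral_normed]
    ring
  obtain ⟨φ, hφ, hφc, hφd⟩ := exists_test_primitive hχ hχc h0
  have key := h φ hφ hφc
  rw [hφd] at key
  have e : ∀ x, f x * (ψ x - (∫ y, ψ y) * b.normed volume x) =
      f x * ψ x - (∫ y, ψ y) * (f x * b.normed volume x) := fun x => by ring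
  simp_rw [e] at key
  rw [integral_sub (hint ψ hψ hψc) ((hint _ hb hbc).const_mul _), integral_const_mul] at key
  simp only [smul_eq_mul]
  rw [integral_mul_const]
  have : ∫ x, ψ x * f x = ∫ x, f x * ψ x := by simp_rw [mul_comm]
  rw [this]
  linarith

/-- Integration by parts for absolutely continuous functions on an interval containing the support;
by Lebesgue differentiation the primitive has derivative g almost everywhere. -/
lemma integral_primitive_mul_deriv {g : ℝ → ℝ} (hg : LocallyIntegrable g volume)
    {φ : ℝ → ℝ} (hφ : ContDiff ℝ ∞ φ) (hc : HasCompactSupport φ) :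
    ∫ x, (∫ t in (0 : ℝ)..x, g t) * deriv φ x = -∫ x, g x * φ x := by
  obtain ⟨K, hK, hsub⟩ := exists_tsupport_subset_Ioo hc
  have hzero : ∀ x, x ∉ Ioo (-K) K → φ x = 0 := fun x hx =>
    image_eq_zero_of_notMem_tsupport fun h => hx (hsub h)
  have hi : IntervalIntegrable g volume (-K) K := intervalIntegrable_of_locallyIntegrable hg _ _
  have h0 : (0 : ℝ) ∈ uIcc (-K) K := by
    rw [uIcc_of_le (by linarith)]; exact ⟨by linarith, hK.le⟩
  have hac := hi.absolutelyContinuousOnInterval_intervalIntegral h0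
  have hφac : AbsolutelyContinuousOnInterval φ (-K) K :=
    (hφ.contDiffOn.of_le (by simp)).absolutelyContinuousOnInterval
  have hp := hac.integral_mul_deriv_eq_deriv_mul hφac
  rw [hzero K (by simp), hzero (-K) (by simp)] at hp
  have e1 : ∫ x in (-K)..K, (∫ t in (0 : ℝ)..x, g t) * deriv φ x =
      ∫ x, (∫ t in (0 : ℝ)..x, g t) * deriv φ x := by
    apply intervalIntegral.integral_eq_integral_of_support_subset
    intro x hx
    have : deriv φ x ≠ 0 := fun h => hx (by simp [h])
    exact Ioo_subset_Ioc_self (hsub (support_deriv_subset this))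
  have e2 : ∫ x in (-K)..K, g x * φ x = ∫ x, g x * φ x := by
    apply intervalIntegral.integral_eq_integral_of_support_subset
    intro x hx
    by_contra h'
    exact hx (by simp [hzero x fun h => h' (Ioo_subset_Ioc_self h)])
  rw [← e1, ← e2, hp]
  have : ∫ x in (-K)..K, deriv (fun x => ∫ t in (0 : ℝ)..x, g t) x * φ x =
      ∫ x in (-K)..K, g x * φ x := by
    apply intervalIntegral.integral_congr_ae
    filter_upwards [_root_.LocallyIntegrable.ae_hasDerivAt_integral hg] with x hx _
    rw [(hx 0).deriv]
  rw [this]; ring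

lemma continuous_primitive {g : ℝ → ℝ} (hg : LocallyIntegrable g volume) :
    Continuous fun x => ∫ t in (0 : ℝ)..x, g t :=
  intervalIntegral.continuous_primitive (fun _ _ => intervalIntegrable_of_locallyIntegrable hg _ _) 0

/-- A function with a weak derivative is almost everywhere a primitive of it. -/
theorem HasWeakDeriv.exists_ae_eq_primitive {u g : ℝ → ℝ} (h : HasWeakDeriv u g) :
    ∃ c : ℝ, u =ᵐ[volume] fun x => c + ∫ t in (0 : ℝ)..x, g t := by
  obtain ⟨hu, hg, hw⟩ := h
  have hv := (continuous_primitive hg).locallyIntegrable (μ := volume)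
  have hint : ∀ {f : ℝ → ℝ}, LocallyIntegrable f volume → ∀ ψ : ℝ → ℝ, ContDiff ℝ ∞ ψ →
      HasCompactSupport ψ → Integrable (fun x => f x * deriv ψ x) := fun hf ψ hψ hc => by
    have := hf.integrable_smul_left_of_hasCompactSupport
      (hψ.continuous_deriv (by simp)) hc.deriv
    simpa [smul_eq_mul, mul_comm] using this
  -- Both u and the primitive of g have weak derivative g, so their difference has weak derivative
  -- zero.
  obtain ⟨c, hc⟩ := ae_eq_const_of_integral_mul_deriv_eq_zero (hu.sub hv) fun φ hφ hφc => by
    have e : ∀ x, ((u - fun x => ∫ t in (0 : ℝ)..x, g t) x) * deriv φ x =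
        u x * deriv φ x - (∫ t in (0 : ℝ)..x, g t) * deriv φ x := fun x => by
      simp [sub_mul]
    simp_rw [e]
    rw [integral_sub (hint hu φ hφ hφc) (hint hv φ hφ hφc), hw φ hφ hφc,
      integral_primitive_mul_deriv hg hφ hφc]
    ring
  refine ⟨c, hc.mono fun x hx => ?_⟩
  simp only [Pi.sub_apply] at hx
  linarith

/-- Classical derivatives are weak derivatives. -/
theorem hasWeakDeriv_of_hasDerivAt {u g : ℝ → ℝ} (h : ∀ x, HasDerivAt u (g x) x)
    (hg : Continuous g) : HasWeakDeriv u g := by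
  have hu : Continuous u := continuous_iff_continuousAt.2 fun x => (h x).continuousAt
  refine ⟨hu.locallyIntegrable, hg.locallyIntegrable, fun φ hφ hc => ?_⟩
  have hφ' : Continuous (deriv φ) := hφ.continuous_deriv (by simp)
  refine integral_mul_deriv_eq_deriv_mul_of_integrable (fun x _ => h x)
    (fun x _ => (hφ.differentiable (by simp) x).hasDerivAt)
    ((hu.mul hφ').integrable_of_hasCompactSupport hc.deriv.mul_left)
    ((hg.mul hφ.continuous).integrable_of_hasCompactSupport hc.mul_left)
    ((hu.mul hφ.continuous).integrable_of_hasCompactSupport hc.mul_left)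

/-! ### Weighted total variation -/

/-- The range of v on the interval is bounded, and a C¹ function is Lipschitz on compact intervals.
-/
lemma _root_.AbsolutelyContinuousOnInterval.contDiff_comp {v F : ℝ → ℝ} {a b : ℝ}
    (hF : ContDiff ℝ 1 F) (hv : AbsolutelyContinuousOnInterval v a b) :
    AbsolutelyContinuousOnInterval (fun x => F (v x)) a b := by
  obtain ⟨L, hL⟩ := hv.exists_bound
  obtain ⟨K, hK⟩ := hF.contDiffOn.exists_lipschitzOnWith (n := 1) (s := Icc (-L) L) (by simp)
    (convex_Icc _ _) isCompact_Icc
  rw [absolutelyContinuousOnInterval_iff] at hv ⊢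
  intro ε hε
  -- The Lipschitz constant K may vanish, hence K + 1.
  obtain ⟨δ, hδ, h⟩ := hv (ε / (K + 1)) (by positivity)
  refine ⟨δ, hδ, fun E hE hlt => ?_⟩
  have hmem : ∀ x ∈ uIcc a b, v x ∈ Icc (-L) L := fun x hx => abs_le.1 (hL x hx)
  have h1 : ∑ i ∈ Finset.range E.1, dist (F (v (E.2 i).1)) (F (v (E.2 i).2)) ≤
      (K + 1) * ∑ i ∈ Finset.range E.1, dist (v (E.2 i).1) (v (E.2 i).2) := by
    rw [Finset.mul_sum]
    refine Finset.sum_le_sum fun i hi => ?_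
    have := hE.1 i (by simpa using hi)
    refine (hK.dist_le_mul _ (hmem _ this.1) _ (hmem _ this.2)).trans ?_
    gcongr
    simp
  refine h1.trans_lt ?_
  have := h E hE hlt
  rw [lt_div_iff₀ (by positivity)] at this
  linarith

/-- The chain rule for F ∘ v, where F is the primitive of Φ: the composition is absolutely
continuous, so it is the integral of its a.e. derivative Φ(v) g. -/
lemma abs_primitive_comp_sub_le {g v Φ : ℝ → ℝ} {c : ℝ} (hg : LocallyIntegrable g volume)
    (hv : ∀ x, v x = c + ∫ t in (0 : ℝ)..x, g t) (hΦ : Continuous Φ) (h0 : ∀ t, 0 ≤ Φ t)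
    {a b : ℝ} (hab : a ≤ b) :
    |(∫ t in (0 : ℝ)..v b, Φ t) - ∫ t in (0 : ℝ)..v a, Φ t| ≤ ∫ x in a..b, |g x| * Φ (v x) := by
  have hd : ∀ x, HasDerivAt (fun x => ∫ t in (0 : ℝ)..x, Φ t) (Φ x) x := fun x =>
    intervalIntegral.integral_hasDerivAt_right (hΦ.intervalIntegrable _ _)
      (hΦ.stronglyMeasurableAtFilter _ _) hΦ.continuousAt
  have hder : deriv (fun x => ∫ t in (0 : ℝ)..x, Φ t) = Φ := funext fun x => (hd x).deriv
  have hF : ContDiff ℝ 1 (fun x => ∫ t in (0 : ℝ)..x, Φ t) := by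
    rw [contDiff_one_iff_deriv]
    exact ⟨fun x => (hd x).differentiableAt, by rw [hder]; exact hΦ⟩
  have hva : v = fun x => v a + ∫ t in a..x, g t := by
    funext x
    rw [hv x, hv a, ← intervalIntegral.integral_add_adjacent_intervals
      (intervalIntegrable_of_locallyIntegrable hg 0 a)
      (intervalIntegrable_of_locallyIntegrable hg a x)]
    ring
  have hac : AbsolutelyContinuousOnInterval v a b := by
    have h1 := (intervalIntegrable_of_locallyIntegrable hg a b)
      |>.absolutelyContinuousOnInterval_intervalIntegral (c := a) (by simp)
    have h2 : AbsolutelyContinuousOnInterval (fun _ : ℝ => v a) a b :=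
      (contDiff_const (n := 1)).contDiffOn.absolutelyContinuousOnInterval
    rw [hva]
    exact h2.add h1
  have hcomp := hac.contDiff_comp hF
  rw [← hcomp.integral_deriv_eq_sub]
  refine (intervalIntegral.abs_integral_le_integral_abs hab).trans (le_of_eq ?_)
  refine intervalIntegral.integral_congr_ae ?_
  filter_upwards [_root_.LocallyIntegrable.ae_hasDerivAt_integral hg] with x hx _
  have hvx : HasDerivAt v (g x) x := by
    rw [funext hv]
    exact (hx 0).const_add c
  have hdx : HasDerivAt (fun x => ∫ t in (0 : ℝ)..v x, Φ t) (Φ (v x) * g x) x :=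
    (hd (v x)).comp x hvx
  rw [hdx.deriv, abs_mul, abs_of_nonneg (h0 _), mul_comm]

/-- Otherwise f ≥ ε on a set of infinite measure, against Markov's inequality. Applied to half-lines
it replaces a statement about limits at infinity. -/
lemma exists_mem_lt_of_integrable {f : ℝ → ℝ} (hf : Integrable f) {s : Set ℝ}
    (hs : volume s = ⊤) {ε : ℝ} (hε : 0 < ε) : ∃ x ∈ s, f x < ε := by
  by_contra! h
  have h1 := hf.measure_norm_ge_lt_top hε
  have h2 : s ⊆ {x | ε ≤ ‖f x‖} := fun x hx => (h x hx).trans (le_abs_self _)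
  have := measure_mono (μ := volume) h2
  rw [hs, top_le_iff] at this
  exact h1.ne this

/-- The total variation of a function vanishing at infinity, measured with the density `Φ`,
is at least twice the `Φ`-height of any of its values. -/
theorem two_mul_primitive_abs_le_integral {g v Φ : ℝ → ℝ} {c r : ℝ}
    (hg : LocallyIntegrable g volume) (hv : ∀ x, v x = c + ∫ t in (0 : ℝ)..x, g t)
    (hΦ : Continuous Φ) (h0 : ∀ t, 0 ≤ Φ t) (heven : ∀ t, Φ (-t) = Φ t) (hr : 0 < r)
    (hvr : Integrable fun x => |v x| ^ r) (hint : Integrable fun x => |g x| * Φ (v x)) (x₀ : ℝ) :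
    2 * ∫ t in (0 : ℝ)..|v x₀|, Φ t ≤ ∫ x, |g x| * Φ (v x) := by
  set F : ℝ → ℝ := fun x => ∫ t in (0 : ℝ)..x, Φ t with hF
  have hFc : Continuous F := intervalIntegral.continuous_primitive (hΦ.intervalIntegrable) 0
  have hmono : ∀ {a b}, a ≤ b → F a ≤ F b := fun {a b} hab => by
    have : F b = F a + ∫ t in a..b, Φ t :=
      (intervalIntegral.integral_add_adjacent_intervals (hΦ.intervalIntegrable _ _)
        (hΦ.intervalIntegrable _ _)).symm
    rw [this]
    linarith [intervalIntegral.integral_nonneg (μ := volume) hab (fun t _ => h0 t)]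
  have hF0 : F 0 = 0 := by simp [hF]
  have hodd : ∀ x, F (-x) = -F x := fun x => by
    have := intervalIntegral.integral_comp_neg (a := (0 : ℝ)) (b := x) Φ
    simp only [neg_zero, heven] at this
    simp only [hF]
    rw [this, intervalIntegral.integral_symm]
  have habs : ∀ x, |F x| = F |x| := fun x => by
    rcases le_total 0 x with h | h
    · rw [abs_of_nonneg h, abs_of_nonneg (hF0 ▸ hmono h)]
    · rw [abs_of_nonpos h, hodd, abs_of_nonpos (hF0 ▸ hmono h)]
  have hstep : ∀ a b, a ≤ b → |F (v b) - F (v a)| ≤ ∫ x in a..b, |g x| * Φ (v x) :=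
    fun a b hab => abs_primitive_comp_sub_le hg hv hΦ h0 hab
  have hnn : ∀ x, 0 ≤ |g x| * Φ (v x) := fun x => mul_nonneg (abs_nonneg _) (h0 _)
  -- Choose a left and b right of x₀ where |v| is below ε; each of the two intervals contributes at
  -- least F|v x₀| - F ε.
  have key : ∀ ε > 0, 2 * F |v x₀| ≤ (∫ x, |g x| * Φ (v x)) + 2 * F ε := fun ε hε => by
    have small : ∀ s : Set ℝ, volume s = ⊤ → ∃ x ∈ s, F |v x| ≤ F ε := fun s hs => by
      obtain ⟨x, hx, hlt⟩ := exists_mem_lt_of_integrable hvr hs (Real.rpow_pos_of_pos hε r)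
      exact ⟨x, hx, hmono ((Real.rpow_lt_rpow_iff (abs_nonneg _) hε.le hr).1 hlt).le⟩
    obtain ⟨a, ha, hFa⟩ := small (Iio x₀) Real.volume_Iio
    obtain ⟨b, hb, hFb⟩ := small (Ioi x₀) Real.volume_Ioi
    have h1 := hstep a x₀ (le_of_lt ha)
    have h2 := hstep x₀ b (le_of_lt hb)
    have h3 := abs_sub_abs_le_abs_sub (F (v x₀)) (F (v a))
    have h4 := abs_sub_abs_le_abs_sub (F (v x₀)) (F (v b))
    rw [abs_sub_comm] at h2
    rw [habs, habs] at h3 h4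
    have h5 : (∫ x in a..x₀, |g x| * Φ (v x)) + (∫ x in x₀..b, |g x| * Φ (v x)) ≤
        ∫ x, |g x| * Φ (v x) := by
      rw [intervalIntegral.integral_add_adjacent_intervals hint.intervalIntegrable
        hint.intervalIntegrable, intervalIntegral.integral_of_le (le_of_lt (lt_trans ha hb))]
      exact setIntegral_le_integral hint (ae_of_all _ hnn)
    linarith
  have hlim : Tendsto (fun ε => (∫ x, |g x| * Φ (v x)) + 2 * F ε) (𝓝[>] 0)
      (𝓝 ((∫ x, |g x| * Φ (v x)) + 2 * F 0)) :=
    ((continuous_const.add (continuous_const.mul hFc)).tendsto 0).mono_left nhdsWithin_le_nhds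
  rw [hF0, mul_zero, add_zero] at hlim
  exact ge_of_tendsto hlim (eventually_mem_nhdsWithin.mono key)

/-! ### The potential, its zero and the momentum density -/

/-- The potential `t^{q+1}/(q+1) - t^{m+1}/(m+1)` of the free boundary problem. -/
noncomputable def pot (q m t : ℝ) : ℝ := t ^ (q + 1) / (q + 1) - t ^ (m + 1) / (m + 1)

/-- The positive zero of the potential, which is the height of the optimal profile. -/
noncomputable def peak (q m : ℝ) : ℝ := ((m + 1) / (q + 1)) ^ (1 / (m - q))

/-- The momentum density `(p/(p-1) · pot)^{1-1/p}`, extended evenly and by zero. -/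
noncomputable def momentum (p q m t : ℝ) : ℝ :=
  (p / (p - 1) * max (pot q m |t|) 0) ^ ((p - 1) / p)

/-- The total variation of the optimal profile measured with the momentum density. -/
noncomputable def action (p q m : ℝ) : ℝ := 2 * ∫ t in (0 : ℝ)..peak q m, momentum p q m t

section
variable {p q m : ℝ}

lemma peak_pos (hq : 0 < q) (hqm : q < m) : 0 < peak q m :=
  Real.rpow_pos_of_pos (div_pos (by linarith) (by linarith)) _

/-- Used to exclude plateaus at maximal height: t^m = t^q fails for t > 1. -/
lemma one_lt_peak (hq : 0 < q) (hqm : q < m) : 1 < peak q m :=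
  Real.one_lt_rpow ((one_lt_div (by linarith)).2 (by linarith))
    (one_div_pos.2 (by linarith))

lemma peak_rpow (hq : 0 < q) (hqm : q < m) : peak q m ^ (m - q) = (m + 1) / (q + 1) := by
  have : m - q ≠ 0 := by linarith
  rw [peak, ← Real.rpow_mul (div_nonneg (by linarith) (by linarith)), one_div,
    inv_mul_cancel₀ this, Real.rpow_one]

/-- This factorisation shows the sign of the potential and suggests the variable s =
(t/`peak`)^{m-q}, in which all later integrals become Beta integrals. -/
lemma pot_eq (hq : 0 < q) (hqm : q < m) {t : ℝ} (ht : 0 ≤ t) :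
    pot q m t = t ^ (q + 1) / (q + 1) * (1 - (t / peak q m) ^ (m - q)) := by
  have h1 : q + 1 ≠ 0 := by linarith
  have h2 : m + 1 ≠ 0 := by linarith
  rw [pot, Real.div_rpow ht (peak_pos hq hqm).le, peak_rpow hq hqm]
  have : t ^ (m + 1) = t ^ (q + 1) * t ^ (m - q) := by
    rw [← Real.rpow_add_of_nonneg ht (by linarith) (by linarith)]; congr 1; ring
  rw [this]
  field_simp

lemma pot_nonneg (hq : 0 < q) (hqm : q < m) {t : ℝ} (ht : 0 ≤ t) (htM : t ≤ peak q m) :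
    0 ≤ pot q m t := by
  rw [pot_eq hq hqm ht]
  have : (t / peak q m) ^ (m - q) ≤ 1 :=
    Real.rpow_le_one (div_nonneg ht (peak_pos hq hqm).le)
      ((div_le_one (peak_pos hq hqm)).2 htM) (by linarith)
  exact mul_nonneg (div_nonneg (Real.rpow_nonneg ht _) (by linarith)) (by linarith)

lemma pot_pos (hq : 0 < q) (hqm : q < m) {t : ℝ} (ht : 0 < t) (htM : t < peak q m) :
    0 < pot q m t := by
  rw [pot_eq hq hqm ht.le]
  have : (t / peak q m) ^ (m - q) < 1 :=
    Real.rpow_lt_one (div_nonneg ht.le (peak_pos hq hqm).le)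
      ((div_lt_one (peak_pos hq hqm)).2 htM) (by linarith)
  exact mul_pos (div_pos (Real.rpow_pos_of_pos ht _) (by linarith)) (by linarith)

lemma pot_zero (hq : 0 < q) (hqm : q < m) : pot q m 0 = 0 := by
  rw [pot, Real.zero_rpow (by linarith), Real.zero_rpow (by linarith)]; simp

lemma pot_peak (hq : 0 < q) (hqm : q < m) : pot q m (peak q m) = 0 := by
  rw [pot_eq hq hqm (peak_pos hq hqm).le, div_self (peak_pos hq hqm).ne']; simp

lemma continuous_pot (hq : 0 < q) (hqm : q < m) : Continuous (pot q m) := by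
  unfold pot
  exact ((Real.continuous_rpow_const (by linarith)).div_const _).sub
    ((Real.continuous_rpow_const (by linarith)).div_const _)

lemma continuous_momentum (hp : 1 < p) (hq : 0 < q) (hqm : q < m) :
    Continuous (momentum p q m) := by
  unfold momentum
  exact (continuous_const.mul (((continuous_pot hq hqm).comp continuous_abs).max
    continuous_const)).rpow_const fun _ => Or.inr (div_nonneg (by linarith) (by linarith))

lemma momentum_nonneg (hp : 1 < p) (t : ℝ) : 0 ≤ momentum p q m t :=
  Real.rpow_nonneg (mul_nonneg (div_nonneg (by linarith) (by linarith)) (le_max_right _ _)) _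

lemma momentum_eq (hq : 0 < q) (hqm : q < m) {t : ℝ} (ht : 0 ≤ t) (htM : t ≤ peak q m) :
    momentum p q m t = (p / (p - 1) * pot q m t) ^ ((p - 1) / p) := by
  rw [momentum, abs_of_nonneg ht, max_eq_left (pot_nonneg hq hqm ht htM)]

lemma momentum_rpow (hp : 1 < p) (hq : 0 < q) (hqm : q < m) {t : ℝ} (ht : |t| ≤ peak q m) :
    momentum p q m t ^ (p / (p - 1)) = p / (p - 1) * pot q m |t| := by
  have h1 : p - 1 ≠ 0 := by linarith
  have h2 : p ≠ 0 := by linarith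
  rw [momentum, max_eq_left (pot_nonneg hq hqm (abs_nonneg _) ht), ← Real.rpow_mul]
  · rw [div_mul_div_comm, mul_comm (p - 1) p, div_self (mul_ne_zero h2 h1), Real.rpow_one]
  · exact mul_nonneg (div_nonneg (by linarith) (by linarith))
      (pot_nonneg hq hqm (abs_nonneg _) ht)

lemma holderConjugate (hp : 1 < p) : p.HolderConjugate (p / (p - 1)) :=
  Real.HolderConjugate.conjExponent hp

/-! ### The calibration inequality -/

lemma memLp_of_integrable_rpow {f : ℝ → ℝ} (hf : Continuous f) (h0 : ∀ x, 0 ≤ f x) {r : ℝ}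
    (hr : 0 < r) (h : Integrable fun x => f x ^ r) : MemLp f (ENNReal.ofReal r) volume := by
  rw [← integrable_norm_rpow_iff hf.aestronglyMeasurable (by simpa using hr) (by simp),
    ENNReal.toReal_ofReal hr.le]
  simpa [Real.norm_eq_abs, abs_of_nonneg (h0 _)] using h

lemma integrable_abs_mul {g f : ℝ → ℝ} (hp : 1 < p) (hg : MemLp g (ENNReal.ofReal p) volume)
    (hf : MemLp f (ENNReal.ofReal (p / (p - 1))) volume) : Integrable fun x => |g x| * f x := by
  have := (holderConjugate hp).ennrealOfReal
  exact MemLp.integrable_mul hg.abs hf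

/-- The variation bound with density |t|^k controls |v|^{k+1} by ∫|g||v|^k, which is finite by
Hölder. Boundedness is needed before v can be rescaled to height `peak`. -/
lemma bddAbove_range_abs_primitive {g v : ℝ → ℝ} {c : ℝ} (hp : 1 < p) (hq : 0 < q)
    (hg : LocallyIntegrable g volume) (hv : ∀ x, v x = c + ∫ t in (0 : ℝ)..x, g t)
    (hgp : MemLp g (ENNReal.ofReal p) volume) (hvq : Integrable fun x => |v x| ^ (q + 1)) :
    BddAbove (range fun x => |v x|) := by
  have hp1 : p - 1 ≠ 0 := by linarith
  have hp0 : p ≠ 0 := by linarith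
  -- Chosen so that the conjugate power of |v|^k is |v|^{q+1}.
  set k := (q + 1) * ((p - 1) / p) with hk
  have hkpos : 0 < k := mul_pos (by linarith) (div_pos (by linarith) (by linarith))
  have hvc : Continuous v := by
    rw [funext hv]; exact continuous_const.add (continuous_primitive hg)
  have hΦc : Continuous fun t : ℝ => |t| ^ k :=
    continuous_abs.rpow_const fun _ => Or.inr hkpos.le
  have hmem : MemLp (fun x => |v x| ^ k) (ENNReal.ofReal (p / (p - 1))) volume := by
    refine memLp_of_integrable_rpow (hΦc.comp hvc) (fun x => Real.rpow_nonneg (abs_nonneg _) _)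
      (div_pos (by linarith) (by linarith)) ?_
    refine hvq.congr (ae_of_all _ fun x => ?_)
    simp only [Function.comp]
    rw [← Real.rpow_mul (abs_nonneg _), hk]
    congr 1
    field_simp
  have key := two_mul_primitive_abs_le_integral hg hv hΦc
    (fun t => Real.rpow_nonneg (abs_nonneg _) _) (fun t => by rw [abs_neg])
    (by linarith : 0 < q + 1) hvq (integrable_abs_mul hp hgp hmem)
  set I := ∫ x, |g x| * |v x| ^ k
  refine ⟨((k + 1) * I / 2) ^ (1 / (k + 1)), ?_⟩
  rintro _ ⟨x, rfl⟩
  have h1 := key x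
  have h2 : ∫ t in (0 : ℝ)..|v x|, |t| ^ k = |v x| ^ (k + 1) / (k + 1) := by
    have : ∫ t in (0 : ℝ)..|v x|, |t| ^ k = ∫ t in (0 : ℝ)..|v x|, t ^ k := by
      refine intervalIntegral.integral_congr fun t ht => ?_
      rw [uIcc_of_le (abs_nonneg _)] at ht
      simp only [abs_of_nonneg ht.1]
    rw [this, integral_rpow (Or.inl (by linarith)), Real.zero_rpow (by linarith), sub_zero]
  rw [h2] at h1
  have h3 : |v x| ^ (k + 1) ≤ (k + 1) * I / 2 := by
    have : 2 * (|v x| ^ (k + 1) / (k + 1)) * (k + 1) ≤ I * (k + 1) :=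
      mul_le_mul_of_nonneg_right h1 (by linarith)
    rw [mul_assoc, div_mul_cancel₀ _ (by linarith)] at this
    linarith
  calc |v x| = (|v x| ^ (k + 1)) ^ (1 / (k + 1)) := by
        rw [← Real.rpow_mul (abs_nonneg _), mul_one_div_cancel (by linarith), Real.rpow_one]
    _ ≤ _ := Real.rpow_le_rpow (Real.rpow_nonneg (abs_nonneg _) _) h3
        (one_div_nonneg.2 (by linarith))

/-- Interpolation with L^∞: |v|^{m+1} ≤ B^{m-q} |v|^{q+1}. -/
lemma integrable_rpow_of_bddAbove {v : ℝ → ℝ} (hv : Continuous v) (hq : 0 < q) (hqm : q < m)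
    {B : ℝ} (hB : ∀ x, |v x| ≤ B) (hvq : Integrable fun x => |v x| ^ (q + 1)) :
    Integrable fun x => |v x| ^ (m + 1) := by
  refine (hvq.mul_const (B ^ (m - q))).mono'
    ((hv.abs.rpow_const fun _ => Or.inr (by linarith)).aestronglyMeasurable)
    (ae_of_all _ fun x => ?_)
  rw [Real.norm_eq_abs, abs_of_nonneg (Real.rpow_nonneg (abs_nonneg _) _)]
  have : |v x| ^ (m + 1) = |v x| ^ (q + 1) * |v x| ^ (m - q) := by
    rw [← Real.rpow_add_of_nonneg (abs_nonneg _) (by linarith) (by linarith)]; congr 1; ring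
  rw [this]
  exact mul_le_mul_of_nonneg_left
    (Real.rpow_le_rpow (abs_nonneg _) (hB x) (by linarith)) (Real.rpow_nonneg (abs_nonneg _) _)

/-- Up to height `peak` the truncation in `momentum` is inactive, so its conjugate power is linear
in the two powers of |v|. This is the second Hölder factor. -/
lemma integral_momentum_rpow {v : ℝ → ℝ} (hp : 1 < p) (hq : 0 < q) (hqm : q < m)
    (hvM : ∀ x, |v x| ≤ peak q m) (hvq : Integrable fun x => |v x| ^ (q + 1))
    (hvm : Integrable fun x => |v x| ^ (m + 1)) :
    Integrable (fun x => momentum p q m (v x) ^ (p / (p - 1))) ∧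
    ∫ x, momentum p q m (v x) ^ (p / (p - 1)) =
      p / (p - 1) * ((∫ x, |v x| ^ (q + 1)) / (q + 1) - (∫ x, |v x| ^ (m + 1)) / (m + 1)) := by
  have e : (fun x => momentum p q m (v x) ^ (p / (p - 1))) =
      fun x => p / (p - 1) * (|v x| ^ (q + 1) / (q + 1) - |v x| ^ (m + 1) / (m + 1)) := by
    funext x; rw [momentum_rpow hp hq hqm (hvM x), pot]
  rw [e]
  refine ⟨((hvq.div_const _).sub (hvm.div_const _)).const_mul _, ?_⟩
  rw [integral_const_mul, integral_sub (hvq.div_const _) (hvm.div_const _), integral_div,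
    integral_div]

/-- The calibration inequality for functions whose height equals that of the profile. -/
theorem action_le {g v : ℝ → ℝ} {c : ℝ} (hp : 1 < p) (hq : 0 < q) (hqm : q < m)
    (hg : LocallyIntegrable g volume) (hv : ∀ x, v x = c + ∫ t in (0 : ℝ)..x, g t)
    (hgp : MemLp g (ENNReal.ofReal p) volume) (hvq : Integrable fun x => |v x| ^ (q + 1))
    (hsup : IsLUB (range fun x => |v x|) (peak q m)) :
    action p q m ≤ (∫ x, |g x| ^ p) ^ (1 / p) *
      (p / (p - 1) * ((∫ x, |v x| ^ (q + 1)) / (q + 1) -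
        (∫ x, |v x| ^ (m + 1)) / (m + 1))) ^ ((p - 1) / p) := by
  have hvM : ∀ x, |v x| ≤ peak q m := fun x => hsup.1 ⟨x, rfl⟩
  have hvc : Continuous v := by
    rw [funext hv]; exact continuous_const.add (continuous_primitive hg)
  have hΦc := continuous_momentum hp hq hqm
  obtain ⟨hi, he⟩ := integral_momentum_rpow hp hq hqm hvM hvq
    (integrable_rpow_of_bddAbove hvc hq hqm hvM hvq)
  have hmem : MemLp (fun x => momentum p q m (v x)) (ENNReal.ofReal (p / (p - 1))) volume :=
    memLp_of_integrable_rpow (hΦc.comp hvc) (fun x => momentum_nonneg hp _)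
      (div_pos (by linarith) (by linarith)) hi
  have key := two_mul_primitive_abs_le_integral hg hv hΦc (momentum_nonneg hp)
    (fun t => by simp [momentum]) (by linarith : 0 < q + 1) hvq (integrable_abs_mul hp hgp hmem)
  have hH := integral_mul_le_Lp_mul_Lq_of_nonneg (holderConjugate hp) (μ := volume)
    (ae_of_all _ fun x => abs_nonneg (g x)) (ae_of_all _ fun x => momentum_nonneg hp (v x))
    hgp.abs hmem
  rw [he, one_div_div] at hH
  refine le_trans ?_ hH
  have hFc : Continuous fun y => ∫ t in (0 : ℝ)..y, momentum p q m t :=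
    intervalIntegral.continuous_primitive hΦc.intervalIntegrable 0
  -- The supremum need not be known to be attained: compare with heights y below `peak`, then let y
  -- increase.
  have hlim : Tendsto (fun y => 2 * ∫ t in (0 : ℝ)..y, momentum p q m t) (𝓝[<] (peak q m))
      (𝓝 (action p q m)) :=
    ((continuous_const.mul hFc).tendsto _).mono_left nhdsWithin_le_nhds
  refine le_of_tendsto hlim (eventually_mem_nhdsWithin.mono fun y hy => ?_)
  obtain ⟨_, ⟨x, rfl⟩, hx⟩ := (lt_isLUB_iff hsup).1 hy
  refine le_trans ?_ (key x)
  have hadd := intervalIntegral.integral_add_adjacent_intervals (μ := volume)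
    (hΦc.intervalIntegrable 0 y) (hΦc.intervalIntegrable y |v x|)
  have := intervalIntegral.integral_nonneg (μ := volume) (le_of_lt hx)
    (fun t _ => momentum_nonneg (q := q) (m := m) hp t)
  linarith

end

/-! ### From the calibration to the multiplicative inequality -/

/-- The best constant, as a function of the action of the optimal profile. -/
noncomputable def constOfAction (p q m A : ℝ) : ℝ :=
  theta p q m ^ (-(theta p q m / p)) * (1 - theta p q m) ^ (theta p q m / p - 1 / (m + 1)) *
    (A * (1 - theta p q m) / theta p q m) ^ (-theta p q m)

section
variable {p q m : ℝ}

lemma eta1_pos (hp : 1 < p) (hq : 0 < q) (hqm : q < m) : 0 < eta1 p m := by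
  have : 0 < (p - 1) * (m + 1) := mul_pos (by linarith) (by linarith)
  unfold eta1; linarith

lemma eta2_pos (hp : 1 < p) (hq : 0 < q) : 0 < eta2 p q := by
  have : 0 < (p - 1) * (q + 1) := mul_pos (by linarith) (by linarith)
  unfold eta2; linarith

lemma theta_eq : theta p q m = p * (m - q) / ((m + 1) * eta2 p q) := by
  rw [theta, eta2, add_comm p]

lemma one_sub_theta_eq (hp : 1 < p) (hq : 0 < q) (hqm : q < m) :
    1 - theta p q m = (q + 1) * eta1 p m / ((m + 1) * eta2 p q) := by
  have h1 : m + 1 ≠ 0 := by linarith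
  have h2 := (eta2_pos hp hq).ne'
  rw [theta_eq, eq_div_iff (mul_ne_zero h1 h2), sub_mul, div_mul_cancel₀ _ (mul_ne_zero h1 h2)]
  unfold eta1 eta2
  ring

lemma theta_pos (hp : 1 < p) (hq : 0 < q) (hqm : q < m) : 0 < theta p q m := by
  rw [theta_eq]
  exact div_pos (mul_pos (by linarith) (by linarith)) (mul_pos (by linarith) (eta2_pos hp hq))

lemma one_sub_theta_pos (hp : 1 < p) (hq : 0 < q) (hqm : q < m) : 0 < 1 - theta p q m := by
  rw [one_sub_theta_eq hp hq hqm]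
  exact div_pos (mul_pos (by linarith) (eta1_pos hp hq hqm))
    (mul_pos (by linarith) (eta2_pos hp hq))

lemma log_theta (hp : 1 < p) (hq : 0 < q) (hqm : q < m) :
    Real.log (theta p q m) =
      Real.log p + Real.log (m - q) - Real.log (m + 1) - Real.log (eta2 p q) := by
  have h1 : p ≠ 0 := by linarith
  have h2 : m - q ≠ 0 := by linarith
  have h3 : m + 1 ≠ 0 := by linarith
  have h4 := (eta2_pos hp hq).ne'
  rw [theta_eq, Real.log_div (mul_ne_zero h1 h2) (mul_ne_zero h3 h4), Real.log_mul h1 h2,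
    Real.log_mul h3 h4]
  ring

lemma log_one_sub_theta (hp : 1 < p) (hq : 0 < q) (hqm : q < m) :
    Real.log (1 - theta p q m) =
      Real.log (q + 1) + Real.log (eta1 p m) - Real.log (m + 1) - Real.log (eta2 p q) := by
  have h1 : q + 1 ≠ 0 := by linarith
  have h2 := (eta1_pos hp hq hqm).ne'
  have h3 : m + 1 ≠ 0 := by linarith
  have h4 := (eta2_pos hp hq).ne'
  rw [one_sub_theta_eq hp hq hqm, Real.log_div (mul_ne_zero h1 h2) (mul_ne_zero h3 h4),
    Real.log_mul h1 h2, Real.log_mul h3 h4]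
  ring

lemma constOfAction_pos (hp : 1 < p) (hq : 0 < q) (hqm : q < m) {A : ℝ} (hA : 0 < A) :
    0 < constOfAction p q m A := by
  have h1 := theta_pos hp hq hqm
  have h2 := one_sub_theta_pos hp hq hqm
  unfold constOfAction
  positivity

lemma log_constOfAction (hp : 1 < p) (hq : 0 < q) (hqm : q < m) {A : ℝ} (hA : 0 < A) :
    Real.log (constOfAction p q m A) =
      -(theta p q m / p) * Real.log (theta p q m) +
        (theta p q m / p - 1 / (m + 1)) * Real.log (1 - theta p q m) -
        theta p q m * (Real.log A + Real.log (1 - theta p q m) - Real.log (theta p q m)) := by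
  have h1 := theta_pos hp hq hqm
  have h2 := one_sub_theta_pos hp hq hqm
  have h3 : 0 < A * (1 - theta p q m) / theta p q m := by positivity
  rw [constOfAction, Real.log_mul (by positivity) (by positivity),
    Real.log_mul (by positivity) (by positivity), Real.log_rpow h1, Real.log_rpow h2,
    Real.log_rpow h3, Real.log_div (by positivity) h1.ne', Real.log_mul hA.ne' h2.ne']
  ring

/-- The weighted arithmetic-geometric mean inequality turns the calibration inequality into the
multiplicative one. -/
lemma rpow_le_of_action_le (hp : 1 < p) (hq : 0 < q) (hqm : q < m) {A N Q D : ℝ} (hA : 0 < A)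
    (hN : 0 < N) (hD : 0 ≤ D) (hY : 0 ≤ Q / (q + 1) - N / (m + 1))
    (h : A ≤ D ^ (1 / p) * (p / (p - 1) * (Q / (q + 1) - N / (m + 1))) ^ ((p - 1) / p)) :
    N ^ (1 / (m + 1)) ≤ constOfAction p q m A * Q ^ ((1 - theta p q m) / (q + 1)) *
      D ^ (theta p q m / p) := by
  have hp0 : 0 < p := by linarith
  have hp1 : 0 < p - 1 := by linarith
  have hq1 : 0 < q + 1 := by linarith
  have hm1 : 0 < m + 1 := by linarith
  have hmq : 0 < m - q := by linarith
  have he1 := eta1_pos hp hq hqm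
  have he2 := eta2_pos hp hq
  set Y := Q / (q + 1) - N / (m + 1) with hYdef
  have hD' : 0 < D := by
    refine hD.lt_of_ne fun h0 => ?_
    rw [← h0, Real.zero_rpow (by positivity), zero_mul] at h
    linarith
  have hY' : 0 < Y := by
    refine hY.lt_of_ne fun h0 => ?_
    rw [← h0, mul_zero, Real.zero_rpow (by positivity), mul_zero] at h
    linarith
  have hZ : 0 < N / (m + 1) := by positivity
  have hQ : 0 < Q := by
    have : 0 < Q / (q + 1) := by linarith
    rwa [lt_div_iff₀ hq1, zero_mul] at this
  have hC := constOfAction_pos hp hq hqm hA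
  have hcal : Real.log A ≤ 1 / p * Real.log D +
      (p - 1) / p * (Real.log p - Real.log (p - 1) + Real.log Y) := by
    have := Real.log_le_log hA h
    rwa [Real.log_mul (by positivity) (by positivity), Real.log_rpow hD',
      Real.log_rpow (by positivity), Real.log_mul (by positivity) hY'.ne',
      Real.log_div hp0.ne' hp1.ne'] at this
  -- The AM-GM weights η₂/η₁ and (p-1)(m-q)/η₁ sum to one. They make the logarithm of Y cancel
  -- against the one in the calibration inequality.
  have hs1 : 1 - eta2 p q / eta1 p m = (p - 1) * (m - q) / eta1 p m := by
    rw [eq_div_iff he1.ne', sub_mul, div_mul_cancel₀ _ he1.ne']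
    unfold eta1 eta2
    ring
  have hamgm : eta2 p q / eta1 p m * (Real.log N - Real.log (m + 1) -
        (Real.log (eta2 p q) - Real.log (eta1 p m))) +
      (p - 1) * (m - q) / eta1 p m * (Real.log Y -
        (Real.log (p - 1) + Real.log (m - q) - Real.log (eta1 p m))) ≤
      Real.log Q - Real.log (q + 1) := by
    have hs : 0 < eta2 p q / eta1 p m := by positivity
    have ht : 0 < (p - 1) * (m - q) / eta1 p m := by positivity
    have := strictConcaveOn_log_Ioi.concaveOn.2
      (x := N / (m + 1) / (eta2 p q / eta1 p m)) (y := Y / ((p - 1) * (m - q) / eta1 p m))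
      (by simp only [mem_Ioi]; positivity) (by simp only [mem_Ioi]; positivity) hs.le ht.le
      (by rw [← hs1]; ring)
    simp only [smul_eq_mul] at this
    rw [mul_div_cancel₀ _ hs.ne', mul_div_cancel₀ _ ht.ne', Real.log_div hZ.ne' hs.ne',
      Real.log_div hN.ne' hm1.ne', Real.log_div he2.ne' he1.ne', Real.log_div hY'.ne' ht.ne',
      Real.log_div (by positivity) he1.ne', Real.log_mul hp1.ne' hmq.ne'] at this
    have e : N / (m + 1) + Y = Q / (q + 1) := by rw [hYdef]; ring
    rw [e, Real.log_div hQ.ne' hq1.ne'] at this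
    exact this
  rw [← Real.log_le_log_iff (by positivity) (by positivity), Real.log_rpow hN,
    Real.log_mul (by positivity) (by positivity), Real.log_mul (by positivity) (by positivity),
    Real.log_rpow hQ, Real.log_rpow hD', log_constOfAction hp hq hqm hA, log_theta hp hq hqm,
    log_one_sub_theta hp hq hqm, one_sub_theta_eq hp hq hqm, theta_eq]
  generalize Real.log A = lA at *
  generalize Real.log N = lN at *
  generalize Real.log Q = lQ at *
  generalize Real.log D = lD at *
  generalize Real.log Y = lY at *
  generalize Real.log p = lp at *
  generalize Real.log (p - 1) = lp1 at *
  generalize Real.log (q + 1) = lq1 at *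
  generalize Real.log (m + 1) = lm1 at *
  generalize Real.log (m - q) = lmq at *
  generalize Real.log (eta1 p m) = l1 at *
  generalize Real.log (eta2 p q) = l2 at *
  -- The multipliers are (1-θ)/(q+1) for AM-GM and θ for the calibration; their sum is exactly the
  -- logarithm of the claim.
  have k1 := mul_nonneg (div_nonneg he1.le (mul_pos hm1 he2).le) (sub_nonneg.2 hamgm)
  have k2 := mul_nonneg (div_nonneg (mul_pos hp0 hmq).le (mul_pos hm1 he2).le)
    (sub_nonneg.2 hcal)
  refine le_of_sub_nonneg (le_of_le_of_eq (add_nonneg k1 k2) ?_)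
  unfold eta1 eta2 at *
  field_simp
  ring

lemma action_pos (hp : 1 < p) (hq : 0 < q) (hqm : q < m) : 0 < action p q m := by
  have h := continuous_momentum hp hq hqm
  refine mul_pos two_pos (intervalIntegral.intervalIntegral_pos_of_pos_on
    (h.intervalIntegrable _ _) (fun t ht => ?_) (peak_pos hq hqm))
  rw [momentum_eq hq hqm ht.1.le ht.2.le]
  exact Real.rpow_pos_of_pos
    (mul_pos (div_pos (by linarith) (by linarith)) (pot_pos hq hqm ht.1 ht.2)) _

lemma integral_abs_mul_rpow (f : ℝ → ℝ) {l r : ℝ} (hl : 0 ≤ l) :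
    ∫ x, |l * f x| ^ r = l ^ r * ∫ x, |f x| ^ r := by
  rw [← integral_const_mul]
  congr 1; funext x
  rw [abs_mul, abs_of_nonneg hl, Real.mul_rpow hl (abs_nonneg _)]

/-- The Gagliardo-Nirenberg inequality for primitives. -/
theorem gagliardoNirenberg_primitive {g v : ℝ → ℝ} {c : ℝ} (hp : 1 < p) (hq : 0 < q)
    (hqm : q < m) (hg : LocallyIntegrable g volume)
    (hv : ∀ x, v x = c + ∫ t in (0 : ℝ)..x, g t)
    (hgp : MemLp g (ENNReal.ofReal p) volume) (hvq : Integrable fun x => |v x| ^ (q + 1)) :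
    (Integrable fun x => |v x| ^ (m + 1)) ∧
    (∫ x, |v x| ^ (m + 1)) ^ (1 / (m + 1)) ≤ constOfAction p q m (action p q m) *
      (∫ x, |v x| ^ (q + 1)) ^ ((1 - theta p q m) / (q + 1)) *
        (∫ x, |g x| ^ p) ^ (theta p q m / p) := by
  have hbdd := bddAbove_range_abs_primitive hp hq hg hv hgp hvq
  have hvc : Continuous v := by
    rw [funext hv]; exact continuous_const.add (continuous_primitive hg)
  set M := ⨆ x, |v x| with hM
  have hlub : IsLUB (range fun x => |v x|) M := isLUB_ciSup hbdd
  have hvm := integrable_rpow_of_bddAbove hvc hq hqm (fun x => hlub.1 ⟨x, rfl⟩) hvq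
  refine ⟨hvm, ?_⟩
  have hm1 : 0 < m + 1 := by linarith
  have hA := action_pos hp hq hqm
  have hC := constOfAction_pos hp hq hqm hA
  have hN0 : 0 ≤ ∫ x, |v x| ^ (m + 1) :=
    integral_nonneg fun x => Real.rpow_nonneg (abs_nonneg _) _
  have hQ0 : 0 ≤ ∫ x, |v x| ^ (q + 1) :=
    integral_nonneg fun x => Real.rpow_nonneg (abs_nonneg _) _
  have hD0 : 0 ≤ ∫ x, |g x| ^ p := integral_nonneg fun x => Real.rpow_nonneg (abs_nonneg _) _
  rcases hN0.eq_or_lt with hN | hN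
  · rw [← hN, Real.zero_rpow (by positivity)]
    positivity
  have hMpos : 0 < M := by
    by_contra hM0
    have : ∀ x, v x = 0 := fun x =>
      abs_nonpos_iff.1 ((hlub.1 ⟨x, rfl⟩ : |v x| ≤ M).trans (not_lt.1 hM0))
    simp [this, Real.zero_rpow hm1.ne'] at hN
  have hpk := peak_pos hq hqm
  -- Rescale the amplitude so that the supremum becomes `peak`; the factor cancels at the end
  -- because (1-θ) + θ = 1.
  set l := peak q m / M with hl
  have hlpos : 0 < l := by positivity
  have hlub' : IsLUB (range fun x => |l * v x|) (peak q m) := by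
    constructor
    · rintro _ ⟨x, rfl⟩
      have : |v x| ≤ M := hlub.1 ⟨x, rfl⟩
      calc |l * v x| = l * |v x| := by rw [abs_mul, abs_of_pos hlpos]
        _ ≤ l * M := by gcongr
        _ = peak q m := by rw [hl]; field_simp
    · intro y hy
      have : M ≤ y / l := hlub.2 (by
        rintro _ ⟨x, rfl⟩
        have : |l * v x| ≤ y := hy ⟨x, rfl⟩
        rw [abs_mul, abs_of_pos hlpos] at this
        simp only
        rw [le_div_iff₀ hlpos]; linarith)
      rw [le_div_iff₀ hlpos, hl] at this
      rwa [mul_div_cancel₀ _ hMpos.ne'] at this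
  have hvq' : Integrable fun x => |l * v x| ^ (q + 1) := by
    have := hvq.const_mul (l ^ (q + 1))
    refine this.congr (ae_of_all _ fun x => ?_)
    simp only [abs_mul, abs_of_pos hlpos, Real.mul_rpow hlpos.le (abs_nonneg _)]
  have hvc' : Continuous fun x => l * v x := continuous_const.mul hvc
  have hvM' : ∀ x, |l * v x| ≤ peak q m := fun x => hlub'.1 ⟨x, rfl⟩
  have hvm' := integrable_rpow_of_bddAbove hvc' hq hqm hvM' hvq'
  have key := action_le hp hq hqm (g := fun x => l * g x) (v := fun x => l * v x) (c := l * c)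
    (hg.smul l) (fun x => by
      rw [hv x, intervalIntegral.integral_const_mul]; ring) (hgp.const_mul l) hvq' hlub'
  have hY : 0 ≤ (∫ x, |l * v x| ^ (q + 1)) / (q + 1) - (∫ x, |l * v x| ^ (m + 1)) / (m + 1) := by
    have h1 := (integral_momentum_rpow hp hq hqm hvM' hvq' hvm').2
    have h2 : 0 ≤ ∫ x, momentum p q m (l * v x) ^ (p / (p - 1)) :=
      integral_nonneg fun x => Real.rpow_nonneg (momentum_nonneg hp _) _
    rw [h1] at h2
    exact nonneg_of_mul_nonneg_right h2 (div_pos (by linarith) (by linarith))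
  have hfin := rpow_le_of_action_le hp hq hqm hA (N := ∫ x, |l * v x| ^ (m + 1))
    (by rw [integral_abs_mul_rpow _ hlpos.le]; positivity)
    (integral_nonneg fun x => Real.rpow_nonneg (abs_nonneg _) _) hY key
  rw [integral_abs_mul_rpow _ hlpos.le, integral_abs_mul_rpow _ hlpos.le,
    integral_abs_mul_rpow _ hlpos.le, Real.mul_rpow (by positivity) hN0,
    Real.mul_rpow (by positivity) hQ0, Real.mul_rpow (by positivity) hD0,
    ← Real.rpow_mul hlpos.le, ← Real.rpow_mul hlpos.le, ← Real.rpow_mul hlpos.le,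
    mul_one_div_cancel hm1.ne', mul_div_cancel₀ _ (by linarith : q + 1 ≠ 0),
    mul_div_cancel₀ _ (by linarith : p ≠ 0), Real.rpow_one] at hfin
  have e : l ^ (1 - theta p q m) * l ^ theta p q m = l := by
    rw [← Real.rpow_add hlpos]; simp
  refine le_of_mul_le_mul_left (hfin.trans (le_of_eq ?_)) hlpos
  conv_rhs => rw [← e]
  ring

end

/-! ### The inequality for extended norms -/

section
variable {p q m : ℝ}

lemma eLpNorm_eq_ofReal {f : ℝ → ℝ} {r : ℝ} (hr : 0 < r)
    (hf : MemLp f (ENNReal.ofReal r) volume) :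
    eLpNorm f (ENNReal.ofReal r) volume = ENNReal.ofReal ((∫ x, |f x| ^ r) ^ (1 / r)) := by
  rw [hf.eLpNorm_eq_integral_rpow_norm (by simpa using hr) (by simp),
    ENNReal.toReal_ofReal hr.le, one_div]
  simp only [Real.norm_eq_abs]

lemma integrable_abs_rpow {f : ℝ → ℝ} {r : ℝ} (hr : 0 < r)
    (hf : MemLp f (ENNReal.ofReal r) volume) : Integrable fun x => |f x| ^ r := by
  have := hf.integrable_norm_rpow (by simpa using hr) (by simp)
  simpa only [ENNReal.toReal_ofReal hr.le, Real.norm_eq_abs] using this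

lemma integral_abs_rpow_nonneg (f : ℝ → ℝ) (r : ℝ) : 0 ≤ ∫ x, |f x| ^ r :=
  integral_nonneg fun _ => Real.rpow_nonneg (abs_nonneg _) _

/-- The Gagliardo-Nirenberg right-hand side in terms of real integrals. -/
lemma ofReal_mul_eLpNorm_rpow_eq {u g : ℝ → ℝ} (hp : 1 < p) (hq : 0 < q) (hqm : q < m)
    (h : MemX p q u g) {C : ℝ} (hC : 0 ≤ C) :
    ENNReal.ofReal C * eLpNorm u (ENNReal.ofReal (q + 1)) volume ^ (1 - theta p q m) *
        eLpNorm g (ENNReal.ofReal p) volume ^ theta p q m =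
      ENNReal.ofReal (C * (∫ x, |u x| ^ (q + 1)) ^ ((1 - theta p q m) / (q + 1)) *
        (∫ x, |g x| ^ p) ^ (theta p q m / p)) := by
  have hth := theta_pos hp hq hqm
  have hth' := one_sub_theta_pos hp hq hqm
  have hQ := integral_abs_rpow_nonneg u (q + 1)
  have hD := integral_abs_rpow_nonneg g p
  rw [eLpNorm_eq_ofReal (by linarith) h.1, eLpNorm_eq_ofReal (by linarith) h.2.2,
    ENNReal.ofReal_rpow_of_nonneg (Real.rpow_nonneg hQ _) hth'.le,
    ENNReal.ofReal_rpow_of_nonneg (Real.rpow_nonneg hD _) hth.le, ← Real.rpow_mul hQ,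
    ← Real.rpow_mul hD, ← ENNReal.ofReal_mul hC,
    ← ENNReal.ofReal_mul (mul_nonneg hC (Real.rpow_nonneg hQ _)), one_div_mul_eq_div,
    one_div_mul_eq_div]

/-- Replacing u by its continuous representative changes no norm, so the inequality for primitives
suffices. -/
theorem constOfAction_mem_gnConstants (hp : 1 < p) (hq : 0 < q) (hqm : q < m) :
    constOfAction p q m (action p q m) ∈ gnConstants p q m := by
  have hC := (constOfAction_pos hp hq hqm (action_pos hp hq hqm)).le
  refine ⟨hC, fun u g h => ?_⟩
  rw [ofReal_mul_eLpNorm_rpow_eq hp hq hqm h hC]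
  obtain ⟨hu, hw, hg⟩ := h
  obtain ⟨c, hc⟩ := hw.exists_ae_eq_primitive
  have hcr : ∀ r : ℝ, (fun x => |u x| ^ r) =ᵐ[volume]
      fun x => |c + ∫ t in (0 : ℝ)..x, g t| ^ r := fun r => hc.mono fun x hx => by
    simp only [hx]
  obtain ⟨hi, hle⟩ := gagliardoNirenberg_primitive (c := c) hp hq hqm hw.2.1 (fun _ => rfl) hg
    ((integrable_abs_rpow (by linarith) hu).congr (hcr _))
  have hum : MemLp u (ENNReal.ofReal (m + 1)) volume := by
    rw [← integrable_norm_rpow_iff hu.1 (by simp; linarith) (by simp),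
      ENNReal.toReal_ofReal (by linarith)]
    exact hi.congr (hcr _).symm
  rw [eLpNorm_eq_ofReal (by linarith) hum, integral_congr_ae (hcr _), integral_congr_ae (hcr _)]
  exact ENNReal.ofReal_le_ofReal hle

end

/-! ### The incomplete Beta function and its inverse -/

section
variable {a b : ℝ}

lemma intervalIntegrable_betaIntegrand (ha : 0 < a) (hb : 0 < b) :
    IntervalIntegrable (fun t : ℝ => t ^ (a - 1) * (1 - t) ^ (b - 1)) volume 0 1 := by
  have h := Complex.betaIntegral_convergent (u := a) (v := b) (by simpa) (by simpa)
  rw [intervalIntegrable_iff, uIoc_of_le zero_le_one] at h ⊢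
  refine (Integrable.re h).congr ?_
  filter_upwards [ae_restrict_mem measurableSet_Ioc] with t ht
  have h1 : (0 : ℝ) ≤ 1 - t := by linarith [ht.2]
  have : (t : ℂ) ^ ((a : ℂ) - 1) * (1 - (t : ℂ)) ^ ((b : ℂ) - 1) =
      ((t ^ (a - 1) * (1 - t) ^ (b - 1) : ℝ) : ℂ) := by
    rw [Complex.ofReal_mul, Complex.ofReal_cpow ht.1.le, Complex.ofReal_cpow h1]
    push_cast; rfl
  simp only [this]
  exact Complex.ofReal_re _

lemma incBeta_one (ha : 0 < a) (hb : 0 < b) : incBeta 1 a b = ProbabilityTheory.beta a b := by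
  rw [ProbabilityTheory.beta_eq_betaIntegralReal a b ha hb, Complex.betaIntegral]
  have : ∫ x in (0 : ℝ)..1, (x : ℂ) ^ ((a : ℂ) - 1) * (1 - (x : ℂ)) ^ ((b : ℂ) - 1) =
      ((incBeta 1 a b : ℝ) : ℂ) := by
    rw [incBeta, ← intervalIntegral.integral_ofReal]
    refine intervalIntegral.integral_congr fun t ht => ?_
    rw [uIcc_of_le zero_le_one] at ht
    have h1 : (0 : ℝ) ≤ 1 - t := by linarith [ht.2]
    rw [Complex.ofReal_mul, Complex.ofReal_cpow ht.1, Complex.ofReal_cpow h1]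
    push_cast; rfl
  rw [this, Complex.ofReal_re]

lemma incBeta_zero (a b : ℝ) : incBeta 0 a b = 0 := by simp [incBeta]

lemma continuousOn_incBeta (ha : 0 < a) (hb : 0 < b) :
    ContinuousOn (fun x => incBeta x a b) (Icc 0 1) := by
  have := intervalIntegral.continuousOn_primitive_interval'
    (intervalIntegrable_betaIntegrand ha hb) (a := 0) (by simp)
  rwa [uIcc_of_le zero_le_one] at this

lemma hasDerivAt_incBeta (ha : 0 < a) (hb : 0 < b) {x : ℝ} (hx : x ∈ Ioo (0 : ℝ) 1) :
    HasDerivAt (fun x => incBeta x a b) (x ^ (a - 1) * (1 - x) ^ (b - 1)) x := by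
  have hc : ContinuousOn (fun t : ℝ => t ^ (a - 1) * (1 - t) ^ (b - 1)) (Ioo 0 1) := by
    refine ContinuousOn.mul ?_ ?_
    · exact continuousOn_id.rpow_const fun t ht => Or.inl ht.1.ne'
    · exact (continuousOn_const.sub continuousOn_id).rpow_const
        fun t ht => Or.inl (sub_pos.2 ht.2).ne'
  refine intervalIntegral.integral_hasDerivAt_right
    ((intervalIntegrable_betaIntegrand ha hb).mono_set ?_)
    (hc.stronglyMeasurableAtFilter isOpen_Ioo x hx) (hc.continuousAt (isOpen_Ioo.mem_nhds hx))
  rw [uIcc_of_le hx.1.le, uIcc_of_le zero_le_one]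
  exact Icc_subset_Icc_right hx.2.le

lemma strictMonoOn_incBeta (ha : 0 < a) (hb : 0 < b) :
    StrictMonoOn (fun x => incBeta x a b) (Icc 0 1) := by
  refine strictMonoOn_of_deriv_pos (convex_Icc 0 1) (continuousOn_incBeta ha hb) fun x hx => ?_
  rw [interior_Icc] at hx
  rw [(hasDerivAt_incBeta ha hb hx).deriv]
  exact mul_pos (Real.rpow_pos_of_pos hx.1 _) (Real.rpow_pos_of_pos (by linarith [hx.2]) _)

lemma incBetaInv_incBeta (ha : 0 < a) (hb : 0 < b) {x : ℝ} (hx : x ∈ Icc (0 : ℝ) 1) :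
    incBetaInv (incBeta x a b) a b = x :=
  (strictMonoOn_incBeta ha hb).injOn.leftInvOn_invFunOn hx

lemma surjOn_incBeta (ha : 0 < a) (hb : 0 < b) :
    SurjOn (fun x => incBeta x a b) (Icc 0 1) (Icc 0 (ProbabilityTheory.beta a b)) := by
  have := intermediate_value_Icc zero_le_one (continuousOn_incBeta ha hb)
  rw [incBeta_zero, incBeta_one ha hb] at this
  exact this

lemma incBetaInv_mem (ha : 0 < a) (hb : 0 < b) {y : ℝ}
    (hy : y ∈ Icc 0 (ProbabilityTheory.beta a b)) : incBetaInv y a b ∈ Icc (0 : ℝ) 1 :=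
  (surjOn_incBeta ha hb).mapsTo_invFunOn hy

lemma incBeta_incBetaInv (ha : 0 < a) (hb : 0 < b) {y : ℝ}
    (hy : y ∈ Icc 0 (ProbabilityTheory.beta a b)) : incBeta (incBetaInv y a b) a b = y :=
  (surjOn_incBeta ha hb).rightInvOn_invFunOn hy

lemma incBetaInv_zero (ha : 0 < a) (hb : 0 < b) : incBetaInv 0 a b = 0 := by
  have := incBetaInv_incBeta ha hb (x := 0) (by simp)
  rwa [incBeta_zero] at this

lemma incBetaInv_beta (ha : 0 < a) (hb : 0 < b) :
    incBetaInv (ProbabilityTheory.beta a b) a b = 1 := by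
  have := incBetaInv_incBeta ha hb (x := 1) (by simp)
  rwa [incBeta_one ha hb] at this

lemma incBetaInv_mem_Ioo (ha : 0 < a) (hb : 0 < b) {y : ℝ}
    (hy : y ∈ Ioo 0 (ProbabilityTheory.beta a b)) : incBetaInv y a b ∈ Ioo (0 : ℝ) 1 := by
  have hy' := Ioo_subset_Icc_self hy
  have h := incBetaInv_mem ha hb hy'
  have he := incBeta_incBetaInv ha hb hy'
  refine ⟨h.1.lt_of_ne fun h0 => ?_, h.2.lt_of_ne fun h1 => ?_⟩
  · rw [← h0, incBeta_zero] at he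
    exact hy.1.ne he
  · rw [h1, incBeta_one ha hb] at he
    exact hy.2.ne' he

lemma continuousOn_incBetaInv (ha : 0 < a) (hb : 0 < b) :
    ContinuousOn (fun y => incBetaInv y a b) (Icc 0 (ProbabilityTheory.beta a b)) := by
  rw [continuousOn_iff_isClosed]
  intro t ht
  -- The preimage of a closed set under the inverse is its image under `incBeta`, and a continuous
  -- map on a compact interval sends closed sets to closed sets.
  refine ⟨(fun x => incBeta x a b) '' (t ∩ Icc 0 1), ?_, ?_⟩
  · exact ((isCompact_Icc.inter_left ht).image_of_continuousOn
      ((continuousOn_incBeta ha hb).mono inter_subset_right)).isClosed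
  · ext y
    constructor
    · rintro ⟨h1, h2⟩
      exact ⟨⟨_, ⟨h1, incBetaInv_mem ha hb h2⟩, incBeta_incBetaInv ha hb h2⟩, h2⟩
    · rintro ⟨⟨x, ⟨h1, h2⟩, rfl⟩, h3⟩
      refine ⟨?_, h3⟩
      simp only [mem_preimage, incBetaInv_incBeta ha hb h2]
      exact h1

lemma hasDerivAt_incBetaInv (ha : 0 < a) (hb : 0 < b) {y : ℝ}
    (hy : y ∈ Ioo 0 (ProbabilityTheory.beta a b)) :
    HasDerivAt (fun y => incBetaInv y a b)
      (incBetaInv y a b ^ (a - 1) * (1 - incBetaInv y a b) ^ (b - 1))⁻¹ y := by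
  have hx := incBetaInv_mem_Ioo ha hb hy
  refine HasDerivAt.of_local_left_inverse (f := fun x => incBeta x a b)
    ((continuousOn_incBetaInv ha hb).continuousAt (Icc_mem_nhds hy.1 hy.2))
    (hasDerivAt_incBeta ha hb hx) ?_ ?_
  · exact (mul_pos (Real.rpow_pos_of_pos hx.1 _)
      (Real.rpow_pos_of_pos (by linarith [hx.2]) _)).ne'
  · filter_upwards [Icc_mem_nhds hy.1 hy.2] with z hz using incBeta_incBetaInv ha hb hz

lemma beta_comm (a b : ℝ) : ProbabilityTheory.beta a b = ProbabilityTheory.beta b a := by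
  rw [ProbabilityTheory.beta, ProbabilityTheory.beta, mul_comm, add_comm]

end

/-! ### Free boundary solutions are zero-energy profiles -/

/-- A compactly supported even function which decreases from `peak q m` to `0` on `[0, R]`
with the speed prescribed by the vanishing of the energy. -/
structure IsProfile (p q m : ℝ) (u : ℝ → ℝ) (R : ℝ) : Prop where
  radius_pos : 0 < R
  even : ∀ x, u x = u |x|
  zero : ∀ r, R ≤ r → u r = 0
  cont : ContinuousOn u (Icc 0 R)
  origin : u 0 = peak q m
  mem : ∀ r ∈ Ioo 0 R, u r ∈ Ioo 0 (peak q m)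
  hasDerivAt : ∀ r ∈ Ioo 0 R, HasDerivAt u (-(p / (p - 1) * pot q m (u r)) ^ (1 / p)) r

section
variable {p q m : ℝ}

lemma hasDerivAt_pot (hq : 0 < q) (hqm : q < m) (t : ℝ) :
    HasDerivAt (pot q m) (t ^ q - t ^ m) t := by
  have h1 := (Real.hasDerivAt_rpow_const (x := t) (p := q + 1) (Or.inr (by linarith))).div_const
    (q + 1)
  have h2 := (Real.hasDerivAt_rpow_const (x := t) (p := m + 1) (Or.inr (by linarith))).div_const
    (m + 1)
  have h := h1.sub h2
  rw [add_sub_cancel_right, add_sub_cancel_right, mul_div_cancel_left₀ _ (by linarith),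
    mul_div_cancel_left₀ _ (by linarith)] at h
  exact h

lemma eq_peak_of_pot_eq_zero (hq : 0 < q) (hqm : q < m) {t : ℝ} (ht : 0 < t)
    (h : pot q m t = 0) : t = peak q m := by
  have hM := peak_pos hq hqm
  rw [pot_eq hq hqm ht.le] at h
  have h1 : (t / peak q m) ^ (m - q) = 1 := by
    rcases mul_eq_zero.1 h with h | h
    · exact absurd h (div_pos (Real.rpow_pos_of_pos ht _) (by linarith)).ne'
    · linarith
  rw [← Real.one_rpow (m - q), Real.rpow_left_inj (div_pos ht hM).le zero_le_one
    (by linarith)] at h1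
  rwa [div_eq_one_iff_eq hM.ne'] at h1

/-- Rewrites the flux of a non-increasing function as a pure power. The case v = 0 is separate
because p - 2 may be negative. -/
lemma abs_neg_rpow_mul_neg (hp : 1 < p) {v : ℝ} (hv : 0 ≤ v) :
    |(-v)| ^ (p - 2) * (-v) = -v ^ (p - 1) := by
  rcases hv.eq_or_lt with h | h
  · rw [← h, Real.zero_rpow (by linarith)]; simp
  · rw [abs_neg, abs_of_pos h, mul_neg]
    rw [← Real.rpow_add_one h.ne']
    congr 2; ring

lemma IsFreeBoundarySolution.continuousOn {u : ℝ → ℝ} {R : ℝ}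
    (h : IsFreeBoundarySolution p q m u R) : ContinuousOn u (Icc 0 R) := fun r hr => by
  apply ContinuousAt.continuousWithinAt
  rcases hr.1.eq_or_lt with h0 | h0
  · rw [← h0]; exact h.deriv_origin.continuousAt
  rcases hr.2.eq_or_lt with h1 | h1
  · rw [h1]; exact h.deriv_radius.continuousAt
  exact (h.differentiable r ⟨h0, h1⟩).continuousAt

lemma IsFreeBoundarySolution.deriv_nonpos {u : ℝ → ℝ} {R : ℝ}
    (h : IsFreeBoundarySolution p q m u R) {r : ℝ} (hr : r ∈ Ioo 0 R) : deriv u r ≤ 0 := by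
  have h1 : AntitoneOn u (Ioo 0 R) := h.mem.2.2.1.mono fun x hx => hx.1.le
  have := h1.derivWithin_nonpos (x := r)
  rwa [derivWithin_of_isOpen isOpen_Ioo hr] at this

/-- Conservation of energy. -/
lemma IsFreeBoundarySolution.exists_energy {u : ℝ → ℝ} {R : ℝ} (hp : 1 < p) (hq : 0 < q)
    (hqm : q < m) (h : IsFreeBoundarySolution p q m u R) :
    ∃ e, ∀ r ∈ Ioo 0 R, (-deriv u r) ^ p = p / (p - 1) * (e + pot q m (u r)) := by
  have hp1 : 0 < p - 1 := by linarith
  set w : ℝ → ℝ := fun s => |deriv u s| ^ (p - 2) * deriv u s with hw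
  have hwv : ∀ r ∈ Ioo 0 R, -w r = (-deriv u r) ^ (p - 1) := fun r hr => by
    have := abs_neg_rpow_mul_neg hp (v := -deriv u r) (by linarith [h.deriv_nonpos hr])
    rw [neg_neg] at this
    rw [hw]; simp only; rw [this, neg_neg]
  -- The equation makes the flux w differentiable, not u'. So |u'|^p is written as a power of -w
  -- with exponent p/(p-1) ≥ 1, differentiable even where w = 0.
  have hv : ∀ r ∈ Ioo 0 R, (-w r) ^ (p / (p - 1)) = (-deriv u r) ^ p := fun r hr => by
    rw [hwv r hr, ← Real.rpow_mul (by linarith [h.deriv_nonpos hr]),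
      mul_div_cancel₀ _ hp1.ne']
  have hv' : ∀ r ∈ Ioo 0 R, (-w r) ^ (p / (p - 1) - 1) = -deriv u r := fun r hr => by
    rw [hwv r hr, ← Real.rpow_mul (by linarith [h.deriv_nonpos hr])]
    rw [mul_sub, mul_div_cancel₀ _ hp1.ne']
    norm_num
  have hE : ∀ r ∈ Ioo 0 R, HasDerivAt
      (fun s => (-w s) ^ (p / (p - 1)) * ((p - 1) / p) - pot q m (u s)) 0 r := fun r hr => by
    obtain ⟨hd, he⟩ := h.equation r hr
    have h1 := (hd.hasDerivAt.neg.rpow_const (p := p / (p - 1))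
      (Or.inr ((one_le_div hp1).2 (by linarith)))).mul_const ((p - 1) / p)
    have h2 := (hasDerivAt_pot hq hqm (u r)).comp r (h.differentiable r hr).hasDerivAt
    have h3 := h1.sub h2
    convert! h3 using 1
    have h4 : deriv w r = u r ^ q - u r ^ m := by linarith
    have h5 := hv' r hr
    simp only [Pi.neg_apply]
    change 0 = -deriv w r * (p / (p - 1)) * (-w r) ^ (p / (p - 1) - 1) * ((p - 1) / p) - _
    rw [h5, h4]
    field_simp
    ring
  obtain ⟨e, he⟩ := isOpen_Ioo.exists_is_const_of_deriv_eq_zero isPreconnected_Ioo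
    (fun r hr => (hE r hr).differentiableAt.differentiableWithinAt) (fun r hr => (hE r hr).deriv)
  refine ⟨e, fun r hr => ?_⟩
  have := he r hr
  simp only [hv r hr] at this
  rw [← this]
  field_simp
  ring

/-- At R both u and u' vanish, so the energy is zero; at the origin u' = 0 and u > 0 then leave only
the height `peak`. Monotonicity fixes the sign of the square-root-type first-order equation. -/
theorem IsFreeBoundarySolution.isProfile {u : ℝ → ℝ} {R : ℝ} (hp : 1 < p) (hq : 0 < q)
    (hqm : q < m) (h : IsFreeBoundarySolution p q m u R) : IsProfile p q m u R := by
  have hp1 : 0 < p - 1 := by linarith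
  have hpp : 0 < p / (p - 1) := div_pos (by linarith) hp1
  have hR := h.radius_pos
  have hcont := h.continuousOn
  obtain ⟨e, he⟩ := h.exists_energy hp hq hqm
  have hdiff : DifferentiableOn ℝ u (Ioo 0 R) := fun r hr =>
    (h.differentiable r hr).differentiableWithinAt
  have hder : ∀ r ∈ Ioo 0 R, deriv u r = -(p / (p - 1) * (e + pot q m (u r))) ^ (1 / p) :=
    fun r hr => by
      rw [← he r hr, ← Real.rpow_mul (by linarith [h.deriv_nonpos hr]),
        mul_one_div_cancel (by linarith), Real.rpow_one, neg_neg]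
  have hnn : ∀ r ∈ Ioo 0 R, 0 ≤ e + pot q m (u r) := fun r hr => by
    have h1 : 0 ≤ (-deriv u r) ^ p := Real.rpow_nonneg (by linarith [h.deriv_nonpos hr]) _
    rw [he r hr] at h1
    exact nonneg_of_mul_nonneg_right h1 hpp
  have hnn' : ∀ r ∈ Icc 0 R, 0 ≤ e + pot q m (u r) := by
    have hc : ContinuousOn (fun r => e + pot q m (u r)) (Icc 0 R) :=
      continuousOn_const.add ((continuous_pot hq hqm).comp_continuousOn hcont)
    intro r hr
    have hcl : closure (Ioo 0 R) = Icc 0 R := closure_Ioo hR.ne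
    rw [← hcl] at hr hc
    exact closure_minimal (t := Ici (0 : ℝ)) (s := (fun r => e + pot q m (u r)) '' Ioo 0 R)
      (by rintro _ ⟨x, hx, rfl⟩; exact hnn x hx) isClosed_Ici
      (hc.image_closure ⟨r, hr, rfl⟩)
  have hcd : ContinuousOn (fun r => -(p / (p - 1) * (e + pot q m (u r))) ^ (1 / p))
      (Icc 0 R) := by
    refine ContinuousOn.neg (ContinuousOn.rpow_const ?_ fun _ _ => Or.inr (by positivity))
    exact continuousOn_const.mul
      (continuousOn_const.add ((continuous_pot hq hqm).comp_continuousOn hcont))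
  have hzero : ∀ x, 0 ≤ x → -(p / (p - 1) * x) ^ (1 / p) = 0 → x = 0 := fun x hx h0 => by
    rw [neg_eq_zero, Real.rpow_eq_zero (by positivity) (by positivity)] at h0
    exact (mul_eq_zero.1 h0).resolve_left hpp.ne'
  have hRmem : R ∈ Icc 0 R := right_mem_Icc.2 hR.le
  have h0mem : (0 : ℝ) ∈ Icc 0 R := left_mem_Icc.2 hR.le
  have hlimR : Tendsto (deriv u) (𝓝[<] R)
      (𝓝 (-(p / (p - 1) * (e + pot q m (u R))) ^ (1 / p))) := by
    have h1 := (hcd R hRmem).mono_left (nhdsWithin_mono R Ioo_subset_Icc_self)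
    rw [nhdsWithin_Ioo_eq_nhdsLT hR] at h1
    refine h1.congr' ?_
    filter_upwards [Ioo_mem_nhdsLT hR] with r hr using (hder r hr).symm
  have hlim0 : Tendsto (deriv u) (𝓝[>] 0)
      (𝓝 (-(p / (p - 1) * (e + pot q m (u 0))) ^ (1 / p))) := by
    have h1 := (hcd 0 h0mem).mono_left (nhdsWithin_mono 0 Ioo_subset_Icc_self)
    rw [nhdsWithin_Ioo_eq_nhdsGT hR] at h1
    refine h1.congr' ?_
    filter_upwards [Ioo_mem_nhdsGT hR] with r hr using (hder r hr).symm
  -- The energy identity is known only inside the interval. Its limits at the ends are one-sided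
  -- derivatives, which must agree with the prescribed zero derivatives.
  have hdR := hasDerivWithinAt_Iic_of_tendsto_deriv hdiff
    ((hcont R hRmem).mono Ioo_subset_Icc_self) (Ioo_mem_nhdsLT hR) hlimR
  have hd0 := hasDerivWithinAt_Ici_of_tendsto_deriv hdiff
    ((hcont 0 h0mem).mono Ioo_subset_Icc_self) (Ioo_mem_nhdsGT hR) hlim0
  have hER := hzero _ (hnn' R hRmem)
    ((uniqueDiffWithinAt_Iic R).eq_deriv _ hdR h.deriv_radius.hasDerivWithinAt)
  have hE0 := hzero _ (hnn' 0 h0mem)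
    ((uniqueDiffWithinAt_Ici 0).eq_deriv _ hd0 h.deriv_origin.hasDerivWithinAt)
  rw [h.zero R le_rfl, pot_zero hq hqm, add_zero] at hER
  rw [hER, zero_add] at hE0
  have horig : u 0 = peak q m :=
    eq_peak_of_pot_eq_zero hq hqm (h.pos 0 ⟨le_rfl, hR⟩) hE0
  have hanti := h.mem.2.2.1
  refine ⟨hR, h.mem.2.1, h.zero, hcont, horig, fun r hr => ⟨h.pos r ⟨hr.1.le, hr.2⟩, ?_⟩,
    fun r hr => ?_⟩
  · have hle : u r ≤ peak q m := horig ▸ hanti (mem_Ici.2 le_rfl) (mem_Ici.2 hr.1.le) hr.1.le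
    refine hle.lt_of_ne fun heq => ?_
    -- Reaching height `peak` at r > 0 would force a plateau on (0, r). The flux vanishes there, so
    -- the equation would read t^m = t^q at t = `peak` > 1.
    have hconst : ∀ s ∈ Ioo 0 r, u s = peak q m := fun s hs =>
      le_antisymm (horig ▸ hanti (mem_Ici.2 le_rfl) (mem_Ici.2 hs.1.le) hs.1.le)
        (heq ▸ hanti (mem_Ici.2 hs.1.le) (mem_Ici.2 hr.1.le) hs.2.le)
    have hd : ∀ s ∈ Ioo 0 r, deriv u s = 0 := fun s hs => by
      have : u =ᶠ[𝓝 s] fun _ => peak q m := by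
        filter_upwards [isOpen_Ioo.mem_nhds hs] with x hx using hconst x hx
      rw [this.deriv_eq, deriv_const]
    have hs : r / 2 ∈ Ioo 0 r := ⟨by linarith [hr.1], by linarith [hr.1]⟩
    have hw : (fun s => |deriv u s| ^ (p - 2) * deriv u s) =ᶠ[𝓝 (r / 2)] fun _ => 0 := by
      filter_upwards [isOpen_Ioo.mem_nhds hs] with x hx
      rw [hd x hx, mul_zero]
    have heqn := (h.equation (r / 2) ⟨hs.1, hs.2.trans hr.2⟩).2
    rw [hw.deriv_eq, deriv_const, zero_add, hconst _ hs] at heqn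
    exact (Real.rpow_lt_rpow_of_exponent_lt (one_lt_peak hq hqm) hqm).ne' heqn
  · have := (h.differentiable r hr).hasDerivAt
    rwa [hder r hr, hER, zero_add] at this

end

/-! ### Profiles solve the free boundary problem -/

/-- A continuous function that has a continuous derivative off a countable set is differentiable
everywhere. -/
lemma hasDerivAt_of_hasDerivAt_off_countable {f g : ℝ → ℝ} {s : Set ℝ} (hs : s.Countable)
    (hf : Continuous f) (hg : Continuous g) (h : ∀ x, x ∉ s → HasDerivAt f (g x) x) (x : ℝ) :
    HasDerivAt f (g x) x := by
  have e : f = fun y => f 0 + ∫ t in (0 : ℝ)..y, g t := by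
    funext y
    rw [integral_eq_of_hasDerivAt_off_countable f g hs hf.continuousOn
      (fun x hx => h x hx.2) (hg.intervalIntegrable _ _)]
    ring
  rw [e]
  exact (intervalIntegral.integral_hasDerivAt_right (hg.intervalIntegrable _ _)
    (hg.stronglyMeasurableAtFilter _ _) hg.continuousAt).const_add _

namespace IsProfile

variable {p q m R : ℝ} {u : ℝ → ℝ}

lemma continuous (h : IsProfile p q m u R) : Continuous u := by
  have h1 : ContinuousOn u (Ici R) :=
    continuousOn_const.congr fun x hx => h.zero x hx
  have h2 := h.cont.union_of_isClosed h1 isClosed_Icc isClosed_Ici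
  rw [Icc_union_Ici_eq_Ici h.radius_pos.le] at h2
  have h3 : u = fun x => u |x| := funext h.even
  rw [h3]
  exact h2.comp_continuous continuous_abs fun x => abs_nonneg x

lemma mem_Icc (hq : 0 < q) (hqm : q < m) (h : IsProfile p q m u R) (x : ℝ) :
    u x ∈ Icc 0 (peak q m) := by
  rw [h.even]
  have hM := (peak_pos hq hqm).le
  rcases (abs_nonneg x).eq_or_lt with h0 | h0
  · rw [← h0, h.origin]; exact ⟨hM, le_rfl⟩
  rcases lt_or_ge |x| R with h1 | h1
  · exact Ioo_subset_Icc_self (h.mem _ ⟨h0, h1⟩)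
  · rw [h.zero _ h1]; exact ⟨le_rfl, hM⟩

lemma pot_nonneg (hq : 0 < q) (hqm : q < m) (h : IsProfile p q m u R) (x : ℝ) :
    0 ≤ pot q m (u x) :=
  NagyGN.pot_nonneg hq hqm (h.mem_Icc hq hqm x).1 (h.mem_Icc hq hqm x).2

/-- The branches meet at the origin because the potential vanishes at `peak`; across ±R continuity
is inherited from u. -/
lemma continuous_speed (hp : 1 < p) (hq : 0 < q) (hqm : q < m) (h : IsProfile p q m u R) :
    Continuous fun x => if x ≤ 0 then (p / (p - 1) * pot q m (u x)) ^ (1 / p)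
      else -(p / (p - 1) * pot q m (u x)) ^ (1 / p) := by
  have hp0 : 1 / p ≠ 0 := by
    have : p ≠ 0 := by linarith
    positivity
  have hP : Continuous fun x => (p / (p - 1) * pot q m (u x)) ^ (1 / p) :=
    (continuous_const.mul ((continuous_pot hq hqm).comp h.continuous)).rpow_const
      fun _ => Or.inr (one_div_nonneg.2 (by linarith))
  refine Continuous.if_le hP hP.neg continuous_id continuous_const fun x hx => ?_
  rw [show x = 0 from hx, h.origin, pot_peak hq hqm, mul_zero, Real.zero_rpow hp0, neg_zero]

/-- The speed of the profile, as a function on the line. -/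
lemma hasDerivAt_line (hp : 1 < p) (hq : 0 < q) (hqm : q < m) (h : IsProfile p q m u R) (x : ℝ) :
    HasDerivAt u (if x ≤ 0 then (p / (p - 1) * pot q m (u x)) ^ (1 / p)
      else -(p / (p - 1) * pot q m (u x)) ^ (1 / p)) x := by
  have hp0 : 1 / p ≠ 0 := by
    have : p ≠ 0 := by linarith
    positivity
  -- Only these three gluing points are not covered by the profile equation, the zero extension or
  -- reflection.
  refine hasDerivAt_of_hasDerivAt_off_countable (s := {0, R, -R})
    (g := fun x => if x ≤ 0 then (p / (p - 1) * pot q m (u x)) ^ (1 / p)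
      else -(p / (p - 1) * pot q m (u x)) ^ (1 / p))
    (by simp) h.continuous (h.continuous_speed hp hq hqm) ?_ x
  · have hpos : ∀ y, 0 < y → y ≠ R →
        HasDerivAt u (-(p / (p - 1) * pot q m (u y)) ^ (1 / p)) y := fun y hy hyR => by
      rcases lt_or_gt_of_ne hyR with hlt | hgt
      · exact h.hasDerivAt y ⟨hy, hlt⟩
      · rw [h.zero y hgt.le, pot_zero hq hqm, mul_zero, Real.zero_rpow hp0, neg_zero]
        have : u =ᶠ[𝓝 y] fun _ => 0 := by
          filter_upwards [Ioi_mem_nhds hgt] with z hz using h.zero z (le_of_lt hz)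
        exact (hasDerivAt_const y 0).congr_of_eventuallyEq this
    intro y hy
    simp only [mem_insert_iff, mem_singleton_iff, not_or] at hy
    rcases lt_or_gt_of_ne hy.1 with hlt | hgt
    · rw [if_pos hlt.le]
      have hev : ∀ z, u (-z) = u z := fun z => by rw [h.even, abs_neg, ← h.even]
      have h1 := (hpos (-y) (by linarith) fun h' => hy.2.2 (by linarith)).comp y
        (hasDerivAt_neg y)
      have h2 : (u ∘ Neg.neg) = u := funext hev
      rw [h2, hev] at h1
      simpa using h1
    · rw [if_neg (not_le.2 hgt)]
      exact hpos y hgt hy.2.1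

lemma deriv_eq (hp : 1 < p) (hq : 0 < q) (hqm : q < m) (h : IsProfile p q m u R) :
    deriv u = fun x => if x ≤ 0 then (p / (p - 1) * pot q m (u x)) ^ (1 / p)
      else -(p / (p - 1) * pot q m (u x)) ^ (1 / p) :=
  funext fun x => (h.hasDerivAt_line hp hq hqm x).deriv

lemma abs_deriv_rpow (hp : 1 < p) (hq : 0 < q) (hqm : q < m) (h : IsProfile p q m u R) (x : ℝ) :
    |deriv u x| ^ p = p / (p - 1) * pot q m (u x) := by
  have h0 : 0 ≤ p / (p - 1) * pot q m (u x) :=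
    mul_nonneg (div_nonneg (by linarith) (by linarith)) (h.pot_nonneg hq hqm x)
  have h1 : |deriv u x| = (p / (p - 1) * pot q m (u x)) ^ (1 / p) := by
    rw [(h.hasDerivAt_line hp hq hqm x).deriv]
    have := Real.rpow_nonneg h0 (1 / p)
    split_ifs
    · exact abs_of_nonneg this
    · rw [abs_neg, abs_of_nonneg this]
  rw [h1, ← Real.rpow_mul h0, one_div_mul_cancel (by linarith), Real.rpow_one]

lemma hasCompactSupport (h : IsProfile p q m u R) : HasCompactSupport u := by
  refine HasCompactSupport.intro (isCompact_Icc (a := -R) (b := R)) fun x hx => ?_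
  rw [h.even]
  refine h.zero _ (le_of_not_gt fun h' => hx ?_)
  exact abs_le.1 h'.le

lemma continuous_deriv (hp : 1 < p) (hq : 0 < q) (hqm : q < m) (h : IsProfile p q m u R) :
    Continuous (deriv u) := by
  rw [h.deriv_eq hp hq hqm]
  exact h.continuous_speed hp hq hqm

lemma memX (hp : 1 < p) (hq : 0 < q) (hqm : q < m) (h : IsProfile p q m u R) :
    MemX p q u (deriv u) :=
  ⟨h.continuous.memLp_of_hasCompactSupport h.hasCompactSupport,
    hasWeakDeriv_of_hasDerivAt
      (fun x => (h.hasDerivAt_line hp hq hqm x).differentiableAt.hasDerivAt)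
      (h.continuous_deriv hp hq hqm),
    (h.continuous_deriv hp hq hqm).memLp_of_hasCompactSupport h.hasCompactSupport.deriv⟩

/-- The momentum of the profile satisfies the equation of motion. -/
lemma hasDerivAt_neg_rpow_pot (hp : 1 < p) (hq : 0 < q) (hqm : q < m) (h : IsProfile p q m u R)
    {r : ℝ} (hr : r ∈ Ioo 0 R) :
    HasDerivAt (fun s => -(p / (p - 1) * pot q m (u s)) ^ ((p - 1) / p)) (u r ^ q - u r ^ m) r := by
  have hp1 : 0 < p - 1 := by linarith
  have hp0 : 0 < p := by linarith
  have hx : 0 < p / (p - 1) * pot q m (u r) :=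
    mul_pos (div_pos hp0 hp1) (pot_pos hq hqm (h.mem r hr).1 (h.mem r hr).2)
  have h1 : HasDerivAt (fun s => p / (p - 1) * pot q m (u s)) _ r :=
    ((hasDerivAt_pot hq hqm (u r)).comp r (h.hasDerivAt r hr)).const_mul (p / (p - 1))
  have h2 := (h1.rpow_const (p := (p - 1) / p) (Or.inl hx.ne')).neg
  convert! h2 using 1
  have e : (p / (p - 1) * pot q m (u r)) ^ (1 / p) *
      (p / (p - 1) * pot q m (u r)) ^ ((p - 1) / p - 1) = 1 := by
    rw [← Real.rpow_add hx]
    have : 1 / p + ((p - 1) / p - 1) = 0 := by field_simp; ring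
    rw [this, Real.rpow_zero]
  have e2 : p / (p - 1) * ((p - 1) / p) = 1 := by field_simp
  set X := (p / (p - 1) * pot q m (u r)) ^ (1 / p)
  set Y := (p / (p - 1) * pot q m (u r)) ^ ((p - 1) / p - 1)
  linear_combination (-(u r ^ q - u r ^ m)) * e - (u r ^ q - u r ^ m) * X * Y * e2

/-- The flux of u is minus the momentum at u, whose derivative is already known. The conditions on
u' hold because the potential vanishes at `peak` and at 0. -/
theorem isFreeBoundarySolution (hp : 1 < p) (hq : 0 < q) (hqm : q < m)
    (h : IsProfile p q m u R) : IsFreeBoundarySolution p q m u R := by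
  have hp1 : 0 < p - 1 := by linarith
  have hp0 : 0 < p := by linarith
  have hd := h.hasDerivAt_line hp hq hqm
  have hz : (0 : ℝ) ^ (1 / p) = 0 := Real.zero_rpow (by positivity)
  have hX : ∀ x, 0 ≤ p / (p - 1) * pot q m (u x) := fun x =>
    mul_nonneg (div_nonneg (by linarith) (by linarith)) (h.pot_nonneg hq hqm x)
  refine ⟨h.radius_pos, ⟨fun x => (h.mem_Icc hq hqm x).1, h.even, ?_, _, h.memX hp hq hqm⟩,
    fun r hr => ?_, h.zero, fun r _ => (hd r).differentiableAt, fun r hr => ?_, ?_, ?_⟩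
  · refine antitoneOn_of_deriv_nonpos (convex_Ici 0) h.continuous.continuousOn
      (fun x _ => (hd x).differentiableAt.differentiableWithinAt) fun x hx => ?_
    rw [interior_Ici] at hx
    rw [(hd x).deriv, if_neg (not_le.2 hx)]
    exact neg_nonpos.2 (Real.rpow_nonneg (hX x) _)
  · rcases hr.1.eq_or_lt with h0 | h0
    · rw [← h0, h.origin]; exact peak_pos hq hqm
    · exact (h.mem r ⟨h0, hr.2⟩).1
  · have hev : (fun s => |deriv u s| ^ (p - 2) * deriv u s) =ᶠ[𝓝 r]
        fun s => -(p / (p - 1) * pot q m (u s)) ^ ((p - 1) / p) := by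
      filter_upwards [isOpen_Ioo.mem_nhds hr] with s hs
      rw [(h.hasDerivAt s hs).deriv, abs_neg_rpow_mul_neg hp (Real.rpow_nonneg (hX s) _),
        ← Real.rpow_mul (hX s), one_div_mul_eq_div]
    have h1 := (h.hasDerivAt_neg_rpow_pot hp hq hqm hr).congr_of_eventuallyEq hev
    exact ⟨h1.differentiableAt, by rw [h1.deriv]; ring⟩
  · have := hd 0
    rwa [if_pos le_rfl, h.origin, pot_peak hq hqm, mul_zero, hz] at this
  · have := hd R
    rwa [if_neg (not_le.2 h.radius_pos), h.zero R le_rfl, pot_zero hq hqm, mul_zero, hz,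
      neg_zero] at this

end IsProfile

/-! ### Explicit constants and construction of the profile -/

section
variable {p q m : ℝ}

lemma log_peak (hq : 0 < q) (hqm : q < m) :
    Real.log (peak q m) = (Real.log (m + 1) - Real.log (q + 1)) / (m - q) := by
  rw [peak, Real.log_rpow (div_pos (by linarith) (by linarith)),
    Real.log_div (by linarith) (by linarith), one_div_mul_eq_div]

lemma cBar_pos (hp : 1 < p) (hq : 0 < q) (hqm : q < m) : 0 < cBar p q m := by
  have h1 : 0 < p - 1 := by linarith
  have h2 : 0 < m - q := by linarith
  have h3 : 0 < m + 1 := by linarith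
  unfold cBar
  positivity

/-- Identities between products of real powers are checked by taking logarithms, which turns them
into rational identities in the exponents. -/
lemma log_cBar (hp : 1 < p) (hq : 0 < q) (hqm : q < m) :
    Real.log (cBar p q m) = 1 / p * (Real.log p - Real.log (p - 1)) + Real.log (m - q) +
      (1 + q - p) / (p * (m - q)) * Real.log (m + 1) +
      (p - m - 1) / (p * (m - q)) * Real.log (q + 1) := by
  have h1 : 0 < p - 1 := by linarith
  have h2 : 0 < m - q := by linarith
  have h3 : 0 < m + 1 := by linarith
  have h4 : 0 < p := by linarith
  have h5 : 0 < q + 1 := by linarith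
  rw [cBar, Real.log_mul (by positivity) (by positivity),
    Real.log_mul (by positivity) (by positivity), Real.log_mul (by positivity) (by positivity),
    Real.log_rpow (by positivity), Real.log_rpow h3, Real.log_rpow h5,
    Real.log_div h4.ne' h1.ne']

/-- Here q < p - 1 enters: the Beta integrand is integrable at 0, which means that the profile
reaches zero at a finite radius. -/
lemma betaParam_pos (hp : 1 < p) (hqp : q < p - 1) (hqm : q < m) :
    0 < (p - 1 - q) / (p * (m - q)) :=
  div_pos (by linarith) (mul_pos (by linarith) (by linarith))

lemma one_sub_one_div_pos (hp : 1 < p) : 0 < 1 - 1 / p := by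
  rw [sub_pos, div_lt_one (by linarith)]; exact hp

/-- The argument of the inverse at r = 0 must be the full Beta value, so that s = 1 and the profile
starts at `peak`. -/
lemma radius_mul_cBar (hp : 1 < p) (hq : 0 < q) (hqp : q < p - 1) (hqm : q < m) :
    cBar p q m * radius p q m =
      ProbabilityTheory.beta ((p - 1 - q) / (p * (m - q))) (1 - 1 / p) := by
  have h1 : 0 < p - 1 := by linarith
  have h2 : 0 < m - q := by linarith
  have h3 : 0 < m + 1 := by linarith
  have h4 : 0 < p := by linarith
  have h5 : 0 < q + 1 := by linarith
  have hc := cBar_pos hp hq hqm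
  have e : (p - (q + 1)) / (p * (m - q)) = (p - 1 - q) / (p * (m - q)) := by ring
  rw [radius, e, beta_comm]
  have hB : 0 < ProbabilityTheory.beta ((p - 1 - q) / (p * (m - q))) (1 - 1 / p) :=
    ProbabilityTheory.beta_pos (betaParam_pos hp hqp hqm) (one_sub_one_div_pos hp)
  set B := ProbabilityTheory.beta ((p - 1 - q) / (p * (m - q))) (1 - 1 / p)
  rw [← mul_assoc]
  conv_rhs => rw [← one_mul B]
  congr 1
  refine Real.log_injOn_pos (mem_Ioi.2 (by positivity)) (mem_Ioi.2 one_pos) ?_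
  rw [Real.log_mul hc.ne' (by positivity), log_cBar hp hq hqm,
    Real.log_mul (by positivity) (by positivity), Real.log_div (by positivity) h2.ne',
    Real.log_mul (by positivity) (by positivity), Real.log_rpow (by positivity),
    Real.log_rpow h3, Real.log_rpow h5, Real.log_div h1.ne' h4.ne', Real.log_one]
  field_simp
  ring

lemma radius_eq (hp : 1 < p) (hq : 0 < q) (hqp : q < p - 1) (hqm : q < m) :
    radius p q m =
      ProbabilityTheory.beta ((p - 1 - q) / (p * (m - q))) (1 - 1 / p) / cBar p q m := by
  rw [← radius_mul_cBar hp hq hqp hqm, mul_div_cancel_left₀ _ (cBar_pos hp hq hqm).ne']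

lemma radius_pos (hp : 1 < p) (hq : 0 < q) (hqp : q < p - 1) (hqm : q < m) :
    0 < radius p q m := by
  rw [radius_eq hp hq hqp hqm]
  exact div_pos (ProbabilityTheory.beta_pos (betaParam_pos hp hqp hqm) (one_sub_one_div_pos hp))
    (cBar_pos hp hq hqm)

lemma div_peak_rpow (hq : 0 < q) (hqm : q < m) {s : ℝ} (hs : 0 ≤ s) :
    (peak q m * s ^ (1 / (m - q)) / peak q m) ^ (m - q) = s := by
  rw [mul_div_cancel_left₀ _ (peak_pos hq hqm).ne', ← Real.rpow_mul hs,
    one_div_mul_cancel (by linarith), Real.rpow_one]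

lemma log_pot (hq : 0 < q) (hqm : q < m) {s : ℝ} (hs : s ∈ Ioo (0 : ℝ) 1) :
    Real.log (pot q m (peak q m * s ^ (1 / (m - q)))) =
      (q + 1) * (Real.log (peak q m) + 1 / (m - q) * Real.log s) - Real.log (q + 1) +
        Real.log (1 - s) := by
  have hM := peak_pos hq hqm
  have hs1 : 0 < 1 - s := by linarith [hs.2]
  have hs0 := hs.1
  have h5 : 0 < q + 1 := by linarith
  rw [pot_eq hq hqm (by positivity), div_peak_rpow hq hqm hs.1.le,
    Real.log_mul (by positivity) hs1.ne', Real.log_div (by positivity) h5.ne',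
    Real.log_rpow (by positivity), Real.log_mul hM.ne' (by positivity), Real.log_rpow hs.1]

lemma peak_mul_rpow_mem (hq : 0 < q) (hqm : q < m) {s : ℝ} (hs : s ∈ Ioo (0 : ℝ) 1) :
    peak q m * s ^ (1 / (m - q)) ∈ Ioo 0 (peak q m) := by
  have hM := peak_pos hq hqm
  refine ⟨mul_pos hM (Real.rpow_pos_of_pos hs.1 _), ?_⟩
  have : s ^ (1 / (m - q)) < 1 :=
    Real.rpow_lt_one hs.1.le hs.2 (one_div_pos.2 (by linarith))
  nlinarith

/-- The speed of the profile in the variable `s = (u / peak)^{m - q}`. -/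
lemma rpow_pot_eq (hp : 1 < p) (hq : 0 < q) (hqm : q < m) {s : ℝ} (hs : s ∈ Ioo (0 : ℝ) 1) :
    (p / (p - 1) * pot q m (peak q m * s ^ (1 / (m - q)))) ^ (1 / p) =
      cBar p q m * (s ^ ((p - 1 - q) / (p * (m - q)) - 1) * (1 - s) ^ (1 - 1 / p - 1))⁻¹ *
        (peak q m * (1 / (m - q) * s ^ (1 / (m - q) - 1))) := by
  have h1 : 0 < p - 1 := by linarith
  have h2 : 0 < m - q := by linarith
  have h3 : 0 < m + 1 := by linarith
  have h4 : 0 < p := by linarith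
  have h5 : 0 < q + 1 := by linarith
  have hc := cBar_pos hp hq hqm
  have hM := peak_pos hq hqm
  have hs0 := hs.1
  have hs1 : 0 < 1 - s := by linarith [hs.2]
  have hmem := peak_mul_rpow_mem hq hqm hs
  have hpot := pot_pos hq hqm hmem.1 hmem.2
  refine Real.log_injOn_pos (mem_Ioi.2 (by positivity)) (mem_Ioi.2 (by positivity)) ?_
  rw [Real.log_rpow (by positivity), Real.log_mul (by positivity) hpot.ne', log_pot hq hqm hs,
    Real.log_div h4.ne' h1.ne', Real.log_mul (by positivity) (by positivity),
    Real.log_mul hc.ne' (by positivity), Real.log_inv,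
    Real.log_mul (by positivity) (by positivity), Real.log_rpow hs0, Real.log_rpow hs1,
    Real.log_mul hM.ne' (by positivity), Real.log_mul (by positivity) (by positivity),
    Real.log_rpow hs0, one_div (m - q), Real.log_inv, log_cBar hp hq hqm, log_peak hq hqm]
  field_simp
  ring

/-- The optimal profile exists. -/
theorem exists_isProfile (hp : 1 < p) (hq : 0 < q) (hqp : q < p - 1) (hqm : q < m) :
    ∃ u, IsProfile p q m u (radius p q m) := by
  have ha := betaParam_pos hp hqp hqm
  have hb := one_sub_one_div_pos hp
  have hR := radius_pos hp hq hqp hqm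
  have hc := cBar_pos hp hq hqm
  have hM := peak_pos hq hqm
  have hcR := radius_mul_cBar hp hq hqp hqm
  have hrp := @rpow_pot_eq p q m hp hq hqm
  have hmq : 0 < 1 / (m - q) := one_div_pos.2 (by linarith)
  set a := (p - 1 - q) / (p * (m - q)) with hadef
  set b := 1 - 1 / p with hbdef
  set R := radius p q m with hRdef
  set k := cBar p q m with hkdef
  set f : ℝ → ℝ := fun r => peak q m * incBetaInv (k * (R - r)) a b ^ (1 / (m - q)) with hf
  have hmaps : MapsTo (fun r => k * (R - r)) (Icc 0 R) (Icc 0 (ProbabilityTheory.beta a b)) :=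
    fun r hr => by
      rw [← hcR]
      exact ⟨mul_nonneg hc.le (by linarith [hr.2]),
        mul_le_mul_of_nonneg_left (by linarith [hr.1]) hc.le⟩
  have hmaps' : ∀ r ∈ Ioo 0 R, k * (R - r) ∈ Ioo 0 (ProbabilityTheory.beta a b) :=
    fun r hr => by
      rw [← hcR]
      exact ⟨mul_pos hc (by linarith [hr.2]),
        mul_lt_mul_of_pos_left (by linarith [hr.1]) hc⟩
  -- Extended evenly, and by zero beyond R, where f vanishes.
  set u : ℝ → ℝ := fun x => if |x| ≤ R then f |x| else 0 with hu
  have huf : ∀ r ∈ Icc 0 R, u r = f r := fun r hr => by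
    simp only [hu]; rw [abs_of_nonneg hr.1, if_pos hr.2]
  have hfR : f R = 0 := by
    simp only [hf]
    rw [sub_self, mul_zero, incBetaInv_zero ha hb, Real.zero_rpow hmq.ne', mul_zero]
  refine ⟨u, hR, fun x => by simp only [hu, abs_abs], fun r hr => ?_, ?_, ?_, fun r hr => ?_,
    fun r hr => ?_⟩
  · rcases hr.eq_or_lt with h | h
    · rw [← h, huf R ⟨hR.le, le_rfl⟩, hfR]
    · simp only [hu]
      rw [abs_of_pos (hR.trans h), if_neg (not_le.2 h)]
  · refine ContinuousOn.congr ?_ huf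
    refine continuousOn_const.mul (ContinuousOn.rpow_const ?_ fun _ _ => Or.inr hmq.le)
    exact (continuousOn_incBetaInv ha hb).comp
      (continuous_const.mul (continuous_const.sub continuous_id)).continuousOn hmaps
  · rw [huf 0 ⟨le_rfl, hR.le⟩]
    simp only [hf]
    rw [sub_zero, hcR, incBetaInv_beta ha hb, Real.one_rpow, mul_one]
  · rw [huf r (Ioo_subset_Icc_self hr)]
    exact peak_mul_rpow_mem hq hqm (incBetaInv_mem_Ioo ha hb (hmaps' r hr))
  · have hs := incBetaInv_mem_Ioo ha hb (hmaps' r hr)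
    have hev : u =ᶠ[𝓝 r] f := by
      filter_upwards [isOpen_Ioo.mem_nhds hr] with x hx using huf x (Ioo_subset_Icc_self hx)
    refine HasDerivAt.congr_of_eventuallyEq ?_ hev
    rw [huf r (Ioo_subset_Icc_self hr)]
    have h1 : HasDerivAt (fun r => k * (R - r)) (k * (-1)) r :=
      ((hasDerivAt_id r).const_sub R).const_mul k
    have h2 := (((hasDerivAt_incBetaInv ha hb (hmaps' r hr)).comp r h1).rpow_const
      (p := 1 / (m - q)) (Or.inl hs.1.ne')).const_mul (peak q m)
    refine h2.congr_deriv ?_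
    simp only [hf, Function.comp]
    rw [hrp hs]
    ring

end

/-! ### Integration of the profile equation and uniqueness -/

namespace IsProfile

variable {p q m R : ℝ} {u : ℝ → ℝ}

lemma eq_peak_mul_rpow (hq : 0 < q) (hqm : q < m) (h : IsProfile p q m u R) (r : ℝ) :
    u r = peak q m * ((u r / peak q m) ^ (m - q)) ^ (1 / (m - q)) := by
  have hM := peak_pos hq hqm
  rw [← Real.rpow_mul (div_nonneg (h.mem_Icc hq hqm r).1 hM.le),
    mul_one_div_cancel (by linarith), Real.rpow_one, mul_div_cancel₀ _ hM.ne']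

lemma div_peak_rpow_mem (hq : 0 < q) (hqm : q < m) (h : IsProfile p q m u R) (r : ℝ) :
    (u r / peak q m) ^ (m - q) ∈ Icc (0 : ℝ) 1 := by
  have hM := peak_pos hq hqm
  have h0 := div_nonneg (h.mem_Icc hq hqm r).1 hM.le
  exact ⟨Real.rpow_nonneg h0 _,
    Real.rpow_le_one h0 ((div_le_one hM).2 (h.mem_Icc hq hqm r).2) (by linarith)⟩

/-- Separation of variables: the left side has constant derivative -`cBar` along the profile and
vanishes at R. -/
lemma incBeta_eq (hp : 1 < p) (hq : 0 < q) (hqp : q < p - 1) (hqm : q < m)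
    (h : IsProfile p q m u R) {r : ℝ} (hr : r ∈ Icc 0 R) :
    incBeta ((u r / peak q m) ^ (m - q)) ((p - 1 - q) / (p * (m - q))) (1 - 1 / p) =
      cBar p q m * (R - r) := by
  have ha := betaParam_pos hp hqp hqm
  have hb := one_sub_one_div_pos hp
  have hM := peak_pos hq hqm
  have hmq : 0 < m - q := by linarith
  have hsc : Continuous fun r => (u r / peak q m) ^ (m - q) :=
    (h.continuous.div_const _).rpow_const fun _ => Or.inr hmq.le
  have hcont : ContinuousOn (fun r => incBeta ((u r / peak q m) ^ (m - q))
      ((p - 1 - q) / (p * (m - q))) (1 - 1 / p)) (Icc r R) :=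
    (continuousOn_incBeta ha hb).comp hsc.continuousOn
      fun x _ => h.div_peak_rpow_mem hq hqm x
  have hder : ∀ x ∈ Ioo r R, HasDerivAt (fun r => incBeta ((u r / peak q m) ^ (m - q))
      ((p - 1 - q) / (p * (m - q))) (1 - 1 / p)) (-cBar p q m) x := fun x hx => by
    have hx' : x ∈ Ioo 0 R := ⟨hr.1.trans_lt hx.1, hx.2⟩
    have hux := h.mem x hx'
    have hy : 0 < u x / peak q m := div_pos hux.1 hM
    have hs : (u x / peak q m) ^ (m - q) ∈ Ioo (0 : ℝ) 1 :=
      ⟨Real.rpow_pos_of_pos hy _, Real.rpow_lt_one hy.le ((div_lt_one hM).2 hux.2) hmq⟩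
    have hd := h.hasDerivAt x hx'
    rw [h.eq_peak_mul_rpow hq hqm x, rpow_pot_eq hp hq hqm hs] at hd
    have h1 := (hasDerivAt_incBeta ha hb hs).comp x
      ((hd.div_const (peak q m)).rpow_const (p := m - q) (Or.inl hy.ne'))
    refine h1.congr_deriv ?_
    have hs1 : 0 < 1 - (u x / peak q m) ^ (m - q) := by linarith [hs.2]
    -- The Jacobians of u ↦ s and s ↦ u cancel.
    have e : ((u x / peak q m) ^ (m - q)) ^ (1 / (m - q) - 1) *
        (u x / peak q m) ^ (m - q - 1) = 1 := by
      rw [← Real.rpow_mul hy.le, ← Real.rpow_add hy]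
      have : (m - q) * (1 / (m - q) - 1) + (m - q - 1) = 0 := by field_simp; ring
      rw [this, Real.rpow_zero]
    have hX := Real.rpow_pos_of_pos hs.1 ((p - 1 - q) / (p * (m - q)) - 1)
    have hY := Real.rpow_pos_of_pos hs1 (1 - 1 / p - 1)
    set X := ((u x / peak q m) ^ (m - q)) ^ ((p - 1 - q) / (p * (m - q)) - 1)
    set Y := (1 - (u x / peak q m) ^ (m - q)) ^ (1 - 1 / p - 1)
    set Z := ((u x / peak q m) ^ (m - q)) ^ (1 / (m - q) - 1)
    set W := (u x / peak q m) ^ (m - q - 1)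
    have : X * Y * (-(cBar p q m * (X * Y)⁻¹ * (peak q m * (1 / (m - q) * Z))) / peak q m *
        (m - q) * W) = -cBar p q m * (Z * W) := by
      field_simp
    rw [this, e, mul_one]
  have hint := intervalIntegral.integral_eq_sub_of_hasDerivAt_of_le hr.2 hcont hder
    intervalIntegrable_const
  rw [intervalIntegral.integral_const, h.zero R le_rfl, zero_div, Real.zero_rpow hmq.ne',
    incBeta_zero, smul_eq_mul] at hint
  linarith

theorem radius_eq (hp : 1 < p) (hq : 0 < q) (hqp : q < p - 1) (hqm : q < m)
    (h : IsProfile p q m u R) : R = radius p q m := by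
  have h0 := h.incBeta_eq hp hq hqp hqm (r := 0) ⟨le_rfl, h.radius_pos.le⟩
  rw [h.origin, div_self (peak_pos hq hqm).ne', Real.one_rpow,
    incBeta_one (betaParam_pos hp hqp hqm) (one_sub_one_div_pos hp),
    ← radius_mul_cBar hp hq hqp hqm, sub_zero] at h0
  exact (mul_left_cancel₀ (cBar_pos hp hq hqm).ne' h0).symm

theorem eq_incBetaInv (hp : 1 < p) (hq : 0 < q) (hqp : q < p - 1) (hqm : q < m)
    (h : IsProfile p q m u R) {r : ℝ} (hr : r ∈ Icc 0 R) :
    u r = ((m + 1) / (q + 1) * incBetaInv (cBar p q m * (R - r))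
      ((p - 1 - q) / (p * (m - q))) (1 - 1 / p)) ^ (1 / (m - q)) := by
  rw [← h.incBeta_eq hp hq hqp hqm hr, incBetaInv_incBeta (betaParam_pos hp hqp hqm)
    (one_sub_one_div_pos hp) (h.div_peak_rpow_mem hq hqm r), ← peak_rpow hq hqm,
    Real.mul_rpow (Real.rpow_nonneg (peak_pos hq hqm).le _) (h.div_peak_rpow_mem hq hqm r).1,
    ← Real.rpow_mul (peak_pos hq hqm).le, mul_one_div_cancel (by linarith), Real.rpow_one,
    ← h.eq_peak_mul_rpow hq hqm r]

theorem unique (hp : 1 < p) (hq : 0 < q) (hqp : q < p - 1) (hqm : q < m) {R' : ℝ} {v : ℝ → ℝ}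
    (hu : IsProfile p q m u R) (hv : IsProfile p q m v R') : u = v := by
  have e : R = R' := (hu.radius_eq hp hq hqp hqm).trans (hv.radius_eq hp hq hqp hqm).symm
  subst e
  funext x
  rw [hu.even, hv.even]
  rcases le_total |x| R with h | h
  · rw [hu.eq_incBetaInv hp hq hqp hqm ⟨abs_nonneg x, h⟩,
      hv.eq_incBetaInv hp hq hqp hqm ⟨abs_nonneg x, h⟩]
  · rw [hu.zero _ h, hv.zero _ h]

end IsProfile

/-! ### The action as a Beta value, and the closed form of the constant -/

section
variable {p q m : ℝ}

/-- The form is that of a chain rule: a constant times the derivative of `incBeta` at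
(t/`peak`)^{m-q}, ready for the fundamental theorem in `action_eq`. -/
lemma momentum_eq_deriv (hp : 1 < p) (hq : 0 < q) (hqm : q < m) {t : ℝ}
    (ht : t ∈ Ioo 0 (peak q m)) :
    momentum p q m t =
      (p / (p - 1) / (q + 1)) ^ ((p - 1) / p) * peak q m ^ ((q + 1) * ((p - 1) / p) + 1) /
        (m - q) * (((t / peak q m) ^ (m - q)) ^ (eta2 p q / (p * (m - q)) - 1) *
        (1 - (t / peak q m) ^ (m - q)) ^ ((2 * p - 1) / p - 1) *
        (1 / peak q m * (m - q) * (t / peak q m) ^ (m - q - 1))) := by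
  have h1 : 0 < p - 1 := by linarith
  have h2 : 0 < m - q := by linarith
  have h4 : 0 < p := by linarith
  have h5 : 0 < q + 1 := by linarith
  have hM := peak_pos hq hqm
  have ht0 := ht.1
  have hy : 0 < t / peak q m := div_pos ht.1 hM
  have hs1 : 0 < 1 - (t / peak q m) ^ (m - q) :=
    sub_pos.2 (Real.rpow_lt_one hy.le ((div_lt_one hM).2 ht.2) h2)
  rw [momentum_eq hq hqm ht.1.le ht.2.le, pot_eq hq hqm ht.1.le]
  refine Real.log_injOn_pos (mem_Ioi.2 (by positivity)) (mem_Ioi.2 (by positivity)) ?_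
  rw [Real.log_rpow (by positivity), Real.log_mul (by positivity) (by positivity),
    Real.log_mul (by positivity) hs1.ne', Real.log_div (by positivity) h5.ne',
    Real.log_rpow ht0,
    Real.log_mul (by positivity) (by positivity), Real.log_div (by positivity) h2.ne',
    Real.log_mul (by positivity) (by positivity), Real.log_rpow (by positivity),
    Real.log_rpow hM, Real.log_mul (by positivity) (by positivity),
    Real.log_mul (by positivity) (by positivity), Real.log_rpow (by positivity),
    Real.log_rpow hy, Real.log_rpow hs1, Real.log_mul (by positivity) (by positivity),
    Real.log_mul (by positivity) h2.ne', Real.log_rpow hy, one_div, Real.log_inv,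
    Real.log_div (x := t) ht0.ne' hM.ne', Real.log_div (y := q + 1) (by positivity) h5.ne']
  unfold eta2
  field_simp
  ring

lemma action_eq (hp : 1 < p) (hq : 0 < q) (hqm : q < m) :
    action p q m = 2 * ((p / (p - 1) / (q + 1)) ^ ((p - 1) / p) *
      peak q m ^ ((q + 1) * ((p - 1) / p) + 1) / (m - q) *
        ProbabilityTheory.beta (eta2 p q / (p * (m - q))) ((2 * p - 1) / p)) := by
  have h2 : 0 < m - q := by linarith
  have h4 : 0 < p := by linarith
  have hM := peak_pos hq hqm
  have ha : 0 < eta2 p q / (p * (m - q)) := div_pos (eta2_pos hp hq) (by positivity)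
  have hb : 0 < (2 * p - 1) / p := div_pos (by linarith) h4
  have hcont : ContinuousOn (fun t => (p / (p - 1) / (q + 1)) ^ ((p - 1) / p) *
      peak q m ^ ((q + 1) * ((p - 1) / p) + 1) / (m - q) *
        incBeta ((t / peak q m) ^ (m - q)) (eta2 p q / (p * (m - q))) ((2 * p - 1) / p))
      (Icc 0 (peak q m)) := by
    refine continuousOn_const.mul ((continuousOn_incBeta ha hb).comp
      ((continuous_id.div_const _).rpow_const fun _ => Or.inr h2.le).continuousOn fun t ht => ?_)
    have h0 : 0 ≤ t / peak q m := div_nonneg ht.1 hM.le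
    exact ⟨Real.rpow_nonneg h0 _, Real.rpow_le_one h0 ((div_le_one hM).2 ht.2) h2.le⟩
  have hint := intervalIntegral.integral_eq_sub_of_hasDerivAt_of_le hM.le hcont
    (f' := momentum p q m) (fun t ht => by
      have hy : 0 < t / peak q m := div_pos ht.1 hM
      have hs : (t / peak q m) ^ (m - q) ∈ Ioo (0 : ℝ) 1 :=
        ⟨Real.rpow_pos_of_pos hy _, Real.rpow_lt_one hy.le ((div_lt_one hM).2 ht.2) h2⟩
      have h1 := ((hasDerivAt_incBeta ha hb hs).comp t
        (((hasDerivAt_id t).div_const (peak q m)).rpow_const (p := m - q)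
          (Or.inl hy.ne'))).const_mul ((p / (p - 1) / (q + 1)) ^ ((p - 1) / p) *
      peak q m ^ ((q + 1) * ((p - 1) / p) + 1) / (m - q))
      rw [momentum_eq_deriv hp hq hqm ht]
      exact h1)
    ((continuous_momentum hp hq hqm).intervalIntegrable _ _)
  rw [div_self hM.ne', Real.one_rpow, incBeta_one ha hb, zero_div, Real.zero_rpow h2.ne',
    incBeta_zero, mul_zero, sub_zero] at hint
  rw [action, hint]

/-- The explicit form of the best constant. -/
theorem nagyConstant_eq (hp : 1 < p) (hq : 0 < q) (hqm : q < m) :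
    nagyConstant p q m = constOfAction p q m (action p q m) := by
  have h1 : 0 < p - 1 := by linarith
  have h2 : 0 < m - q := by linarith
  have h3 : 0 < m + 1 := by linarith
  have h4 : 0 < p := by linarith
  have h5 : 0 < q + 1 := by linarith
  have hM := peak_pos hq hqm
  have hA := action_pos hp hq hqm
  have he1 := eta1_pos hp hq hqm
  have he2 := eta2_pos hp hq
  have hB : 0 < ProbabilityTheory.beta (eta2 p q / (p * (m - q))) ((2 * p - 1) / p) :=
    ProbabilityTheory.beta_pos (by positivity) (div_pos (by linarith) h4)
  have hlA : Real.log (action p q m) = Real.log 2 + (p - 1) / p * (Real.log p - Real.log (p - 1) -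
      Real.log (q + 1)) + ((q + 1) * ((p - 1) / p) + 1) * Real.log (peak q m) -
      Real.log (m - q) +
      Real.log (ProbabilityTheory.beta (eta2 p q / (p * (m - q))) ((2 * p - 1) / p)) := by
    rw [action_eq hp hq hqm, Real.log_mul (by positivity) (by positivity),
      Real.log_mul (by positivity) hB.ne', Real.log_div (by positivity) h2.ne',
      Real.log_mul (by positivity) (by positivity), Real.log_rpow (by positivity),
      Real.log_rpow hM, Real.log_div (by positivity) h5.ne', Real.log_div h4.ne' h1.ne']
    ring
  set B := ProbabilityTheory.beta (eta2 p q / (p * (m - q))) ((2 * p - 1) / p) with hBdef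
  refine Real.log_injOn_pos (mem_Ioi.2 ?_) (mem_Ioi.2 (constOfAction_pos hp hq hqm hA)) ?_
  · unfold nagyConstant
    rw [← hBdef]
    positivity
  rw [log_constOfAction hp hq hqm hA, hlA, log_theta hp hq hqm, log_one_sub_theta hp hq hqm,
    log_peak hq hqm, nagyConstant, ← hBdef, Real.log_rpow (by positivity),
    Real.log_mul (by positivity) (by positivity), Real.log_rpow hB,
    Real.log_div (by positivity) (by positivity), Real.log_mul (by positivity) (by positivity),
    Real.log_mul (by positivity) (by positivity), Real.log_mul (by positivity) (by positivity),
    Real.log_rpow two_pos, Real.log_rpow h1, Real.log_rpow he1, Real.log_rpow h2,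
    Real.log_rpow he2, theta_eq, ell, ← eta2]
  generalize Real.log B = lB
  generalize Real.log 2 = l2
  generalize Real.log p = lp
  generalize Real.log (p - 1) = lp1
  generalize Real.log (q + 1) = lq1
  generalize Real.log (m + 1) = lm1
  generalize Real.log (m - q) = lmq
  generalize Real.log (eta1 p m) = le1
  generalize Real.log (eta2 p q) = le2
  unfold eta1 eta2 at *
  field_simp
  ring

lemma integral_eq_two_mul_of_even {f : ℝ → ℝ} {R : ℝ} (hR : 0 ≤ R) (heven : ∀ x, f x = f |x|)
    (hzero : ∀ r, R < r → f r = 0) : ∫ x, f x = 2 * ∫ x in (0 : ℝ)..R, f x := by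
  have h1 : ∫ x, f x = ∫ x, f |x| := by congr 1; exact funext heven
  rw [h1, integral_comp_abs, intervalIntegral.integral_of_le hR]
  congr 1
  refine (setIntegral_eq_of_subset_of_forall_sdiff_eq_zero measurableSet_Ioi
    Ioc_subset_Ioi_self fun x hx => hzero x ?_)
  by_contra h
  exact hx.2 ⟨hx.1, not_lt.1 h⟩

end

/-! ### Norms of the profile and extremality -/

namespace IsProfile

variable {p q m R : ℝ} {u : ℝ → ℝ}

lemma continuous_rpow (h : IsProfile p q m u R) {k : ℝ} (hk : 0 ≤ k) :
    Continuous fun x => u x ^ k :=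
  h.continuous.rpow_const fun _ => Or.inr hk

lemma integral_rpow_eq (h : IsProfile p q m u R) {k : ℝ} (hk : 0 < k) :
    ∫ x, u x ^ k = 2 * ∫ x in (0 : ℝ)..R, u x ^ k :=
  integral_eq_two_mul_of_even h.radius_pos.le (fun x => by rw [h.even x])
    fun r hr => by rw [h.zero r hr.le, Real.zero_rpow hk.ne']

/-- Change of variable t = u(x): momentum times speed is p/(p-1) times the potential, the exponents
(p-1)/p and 1/p adding to one. -/
lemma integral_pot (hp : 1 < p) (hq : 0 < q) (hqm : q < m) (h : IsProfile p q m u R) :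
    2 * ∫ x in (0 : ℝ)..R, p / (p - 1) * pot q m (u x) = action p q m := by
  have hp1 : 0 < p - 1 := by linarith
  have hp0 : 0 < p := by linarith
  have hm := continuous_momentum hp hq hqm
  have hF : ∀ y, HasDerivAt (fun y => ∫ t in (0 : ℝ)..y, momentum p q m t)
      (momentum p q m y) y := fun y =>
    intervalIntegral.integral_hasDerivAt_right (hm.intervalIntegrable _ _)
      (hm.stronglyMeasurableAtFilter _ _) hm.continuousAt
  have hFc : Continuous fun y => ∫ t in (0 : ℝ)..y, momentum p q m t :=
    intervalIntegral.continuous_primitive hm.intervalIntegrable 0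
  have hint := intervalIntegral.integral_eq_sub_of_hasDerivAt_of_le h.radius_pos.le
    (hFc.comp h.continuous).continuousOn
    (f' := fun x => -(p / (p - 1) * pot q m (u x))) (fun x hx => by
      refine ((hF (u x)).comp x (h.hasDerivAt x hx)).congr_deriv ?_
      have hu := h.mem x hx
      have hx : 0 < p / (p - 1) * pot q m (u x) :=
        mul_pos (div_pos hp0 hp1) (pot_pos hq hqm hu.1 hu.2)
      rw [momentum_eq hq hqm hu.1.le hu.2.le, mul_neg, ← Real.rpow_add hx]
      have : (p - 1) / p + 1 / p = 1 := by field_simp; ring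
      rw [this, Real.rpow_one])
    ((continuous_const.mul
      ((continuous_pot hq hqm).comp h.continuous)).neg.intervalIntegrable _ _)
  simp only [Function.comp] at hint
  rw [h.zero R le_rfl, h.origin, intervalIntegral.integral_same,
    intervalIntegral.integral_neg] at hint
  rw [action]
  linarith

/-- The equation tested with u. The integrand is the derivative of u times the flux, and the
boundary terms vanish since the flux is zero at the origin and u is zero at R. -/
lemma integral_equation (hp : 1 < p) (hq : 0 < q) (hqm : q < m) (h : IsProfile p q m u R) :
    ∫ x in (0 : ℝ)..R, (p / (p - 1) * pot q m (u x) + (u x ^ (q + 1) - u x ^ (m + 1))) = 0 := by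
  have hp1 : 0 < p - 1 := by linarith
  have hp0 : 0 < p := by linarith
  have hpe : 0 < (p - 1) / p := by positivity
  have hpc : Continuous fun x => p / (p - 1) * pot q m (u x) :=
    continuous_const.mul ((continuous_pot hq hqm).comp h.continuous)
  have hcont : Continuous fun x => u x * -(p / (p - 1) * pot q m (u x)) ^ ((p - 1) / p) :=
    h.continuous.mul (hpc.rpow_const fun _ => Or.inr hpe.le).neg
  have hint := intervalIntegral.integral_eq_sub_of_hasDerivAt_of_le h.radius_pos.le
    hcont.continuousOn
    (f' := fun x => p / (p - 1) * pot q m (u x) + (u x ^ (q + 1) - u x ^ (m + 1)))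
    (fun x hx => by
      refine ((h.hasDerivAt x hx).mul
        (h.hasDerivAt_neg_rpow_pot hp hq hqm hx)).congr_deriv ?_
      have hu := h.mem x hx
      have hx : 0 < p / (p - 1) * pot q m (u x) :=
        mul_pos (div_pos hp0 hp1) (pot_pos hq hqm hu.1 hu.2)
      rw [neg_mul_neg, ← Real.rpow_add hx, Real.rpow_add_one hu.1.ne',
        Real.rpow_add_one hu.1.ne']
      have : 1 / p + (p - 1) / p = 1 := by field_simp; ring
      rw [this, Real.rpow_one]
      ring)
    ((hpc.add ((h.continuous_rpow (by linarith)).sub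
      (h.continuous_rpow (by linarith)))).intervalIntegrable _ _)
  rw [hint, h.zero R le_rfl, h.origin, pot_peak hq hqm, mul_zero, Real.zero_rpow hpe.ne']
  ring

/-- The norms of the profile in terms of its action. -/
theorem integrals_eq (hp : 1 < p) (hq : 0 < q) (hqm : q < m) (h : IsProfile p q m u R) :
    ∫ x, u x ^ (q + 1) = action p q m * (1 - theta p q m) / theta p q m ∧
    ∫ x, u x ^ (m + 1) = action p q m / theta p q m := by
  have hp1 : 0 < p - 1 := by linarith
  have hp0 : 0 < p := by linarith
  have hq1 : 0 < q + 1 := by linarith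
  have hm1 : 0 < m + 1 := by linarith
  have hmq : 0 < m - q := by linarith
  have he1 := eta1_pos hp hq hqm
  have he2 := eta2_pos hp hq
  have hiq : IntervalIntegrable (fun x => u x ^ (q + 1)) volume 0 R :=
    (h.continuous_rpow hq1.le).intervalIntegrable _ _
  have him : IntervalIntegrable (fun x => u x ^ (m + 1)) volume 0 R :=
    (h.continuous_rpow hm1.le).intervalIntegrable _ _
  have hpc : Continuous fun x => p / (p - 1) * pot q m (u x) :=
    continuous_const.mul ((continuous_pot hq hqm).comp h.continuous)
  have k1 := h.integral_pot hp hq hqm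
  have k2 := h.integral_equation hp hq hqm
  rw [intervalIntegral.integral_add (hpc.intervalIntegrable _ _) (hiq.sub him),
    intervalIntegral.integral_sub hiq him] at k2
  have k3 : ∫ x in (0 : ℝ)..R, p / (p - 1) * pot q m (u x) =
      p / (p - 1) * ((∫ x in (0 : ℝ)..R, u x ^ (q + 1)) / (q + 1) -
        (∫ x in (0 : ℝ)..R, u x ^ (m + 1)) / (m + 1)) := by
    simp only [pot]
    rw [intervalIntegral.integral_const_mul,
      intervalIntegral.integral_sub (hiq.div_const _) (him.div_const _),
      intervalIntegral.integral_div, intervalIntegral.integral_div]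
  rw [h.integral_rpow_eq hq1, h.integral_rpow_eq hm1, one_sub_theta_eq hp hq hqm, theta_eq]
  rw [← k1]
  generalize (∫ x in (0 : ℝ)..R, u x ^ (q + 1)) = Q at *
  generalize (∫ x in (0 : ℝ)..R, u x ^ (m + 1)) = N at *
  generalize (∫ x in (0 : ℝ)..R, p / (p - 1) * pot q m (u x)) = P at *
  -- With `k3` this is a linear system that determines Q and N from P, half the action.
  have hN : N = P + Q := by linarith
  subst hN
  have hQ : Q * (p * (m - q)) = P * ((q + 1) * eta1 p m) := by
    field_simp at k3
    unfold eta1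
    linarith
  have hQ' : Q = P * ((q + 1) * eta1 p m) / (p * (m - q)) := by
    rw [eq_div_iff (by positivity)]; exact hQ
  rw [hQ']
  have r1 : (m + 1) * eta2 p q = p * (m - q) + (q + 1) * eta1 p m := by unfold eta1 eta2; ring
  constructor
  · field_simp
  · field_simp
    rw [mul_assoc, r1]

end IsProfile

namespace IsProfile

variable {p q m R : ℝ} {u : ℝ → ℝ}

lemma integral_abs_rpow (hq : 0 < q) (hqm : q < m) (h : IsProfile p q m u R) (k : ℝ) :
    ∫ x, |u x| ^ k = ∫ x, u x ^ k := by
  congr 1; funext x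
  rw [abs_of_nonneg (h.mem_Icc hq hqm x).1]

lemma integral_abs_deriv_rpow (hp : 1 < p) (hq : 0 < q) (hqm : q < m)
    (h : IsProfile p q m u R) : ∫ x, |deriv u x| ^ p = action p q m := by
  rw [← h.integral_pot hp hq hqm]
  simp_rw [h.abs_deriv_rpow hp hq hqm]
  refine integral_eq_two_mul_of_even h.radius_pos.le (fun x => by rw [h.even x]) fun r hr => ?_
  rw [h.zero r hr.le, pot_zero hq hqm, mul_zero]

/-- The profile is an extremal function. -/
theorem extremal (hp : 1 < p) (hq : 0 < q) (hqm : q < m) (h : IsProfile p q m u R) :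
    (∫ x, |u x| ^ (m + 1)) ^ (1 / (m + 1)) = constOfAction p q m (action p q m) *
      (∫ x, |u x| ^ (q + 1)) ^ ((1 - theta p q m) / (q + 1)) *
        (∫ x, |deriv u x| ^ p) ^ (theta p q m / p) := by
  have hA := action_pos hp hq hqm
  have hC := constOfAction_pos hp hq hqm hA
  have h1 := theta_pos hp hq hqm
  have h2 := one_sub_theta_pos hp hq hqm
  obtain ⟨hQ, hN⟩ := h.integrals_eq hp hq hqm
  rw [h.integral_abs_rpow hq hqm, h.integral_abs_rpow hq hqm, hQ, hN,
    h.integral_abs_deriv_rpow hp hq hqm]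
  refine Real.log_injOn_pos (mem_Ioi.2 (by positivity)) (mem_Ioi.2 (by positivity)) ?_
  rw [Real.log_rpow (by positivity), Real.log_div hA.ne' h1.ne',
    Real.log_mul (by positivity) (by positivity), Real.log_mul hC.ne' (by positivity),
    Real.log_rpow (by positivity), Real.log_rpow hA, Real.log_div (by positivity) h1.ne',
    Real.log_mul hA.ne' h2.ne', log_constOfAction hp hq hqm hA]
  -- Balance of the powers of the action; it is also the dilation invariance that determines θ.
  have hsc : 1 / (m + 1) = -theta p q m + (1 - theta p q m) / (q + 1) + theta p q m / p := by
    have hp0 : 0 < p := by linarith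
    have hq1 : 0 < q + 1 := by linarith
    have hm1 : 0 < m + 1 := by linarith
    have he2 := eta2_pos hp hq
    rw [one_sub_theta_eq hp hq hqm, theta_eq]
    unfold eta1 eta2 at *
    field_simp
    ring
  rw [hsc]
  ring

end IsProfile

/-! ### Sharpness and conclusion -/

variable {p q m : ℝ}

/-- Any admissible constant, tested on the profile, is compared with an equality whose norm factors
are positive and can be divided out. -/
theorem isLeast_nagyConstant (hp : 1 < p) (hq : 0 < q) (hqp : q < p - 1) (hqm : q < m) :
    IsLeast (gnConstants p q m) (nagyConstant p q m) := by
  rw [nagyConstant_eq hp hq hqm]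
  refine ⟨constOfAction_mem_gnConstants hp hq hqm, fun C hC => ?_⟩
  obtain ⟨u, hu⟩ := exists_isProfile hp hq hqp hqm
  have hX := hu.memX hp hq hqm
  have hle := hC.2 u (deriv u) hX
  have hum : MemLp u (ENNReal.ofReal (m + 1)) volume :=
    hu.continuous.memLp_of_hasCompactSupport hu.hasCompactSupport
  have hA := action_pos hp hq hqm
  have h1 := theta_pos hp hq hqm
  have h2 := one_sub_theta_pos hp hq hqm
  have hQ : 0 < ∫ x, |u x| ^ (q + 1) := by
    rw [hu.integral_abs_rpow hq hqm, (hu.integrals_eq hp hq hqm).1]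
    positivity
  have hD : 0 < ∫ x, |deriv u x| ^ p := by
    rw [hu.integral_abs_deriv_rpow hp hq hqm]; exact hA
  rw [ofReal_mul_eLpNorm_rpow_eq hp hq hqm hX hC.1, eLpNorm_eq_ofReal (by linarith) hum,
    hu.extremal hp hq hqm, ENNReal.ofReal_le_ofReal_iff
      (mul_nonneg (mul_nonneg hC.1 (Real.rpow_nonneg hQ.le _)) (Real.rpow_nonneg hD.le _)),
    mul_assoc, mul_assoc] at hle
  exact le_of_mul_le_mul_right hle
    (mul_pos (Real.rpow_pos_of_pos hQ _) (Real.rpow_pos_of_pos hD _))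

end NagyGN

theorem theorem6p1 (p q m : ℝ) (hp : 1 < p) (hq : 0 < q) (hqp : q < min (p - 1) m) :
    (∃! u : ℝ → ℝ, ∃ R : ℝ, NagyGN.IsFreeBoundarySolution p q m u R) ∧
    (∀ (u : ℝ → ℝ) (R : ℝ), NagyGN.IsFreeBoundarySolution p q m u R →
      R = NagyGN.radius p q m ∧
      (∀ r ∈ Set.Icc (0 : ℝ) R,
        u r = ((m + 1) / (q + 1) *
          NagyGN.incBetaInv (NagyGN.cBar p q m * (R - r))
            ((p - 1 - q) / (p * (m - q))) (1 - 1 / p)) ^ (1 / (m - q))) ∧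
      u 0 = ((m + 1) / (q + 1)) ^ (1 / (m - q)) ∧
      NagyGN.nagyConstant p q m =
        NagyGN.theta p q m ^ (-(NagyGN.theta p q m / p)) *
          (1 - NagyGN.theta p q m) ^ (NagyGN.theta p q m / p - 1 / (m + 1)) *
          (∫ x : ℝ, u x ^ (q + 1)) ^ (-NagyGN.theta p q m)) ∧
    IsLeast (NagyGN.gnConstants p q m) (NagyGN.nagyConstant p q m) := by
  obtain ⟨hqp, hqm⟩ := lt_min_iff.1 hqp
  refine ⟨?_, fun u R h => ?_, NagyGN.isLeast_nagyConstant hp hq hqp hqm⟩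
  · obtain ⟨u, hu⟩ := NagyGN.exists_isProfile hp hq hqp hqm
    refine ⟨u, ⟨_, hu.isFreeBoundarySolution hp hq hqm⟩, ?_⟩
    rintro v ⟨R, hv⟩
    exact (hv.isProfile hp hq hqm).unique hp hq hqp hqm hu
  · have hP := h.isProfile hp hq hqm
    refine ⟨hP.radius_eq hp hq hqp hqm, fun r hr => hP.eq_incBetaInv hp hq hqp hqm hr,
      hP.origin, ?_⟩
    rw [NagyGN.nagyConstant_eq hp hq hqm, (hP.integrals_eq hp hq hqm).1]
    -- With the integral of u^{q+1} replaced by its value in terms of the action, the stated formula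
    -- is the definition of `constOfAction`.
    rfl
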